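/- Theorem 2.1. Let $(M_k)_{k\ge 1}$ be a sequence of real matrices with entries in $[-1,1]$, where $M_k=(m_{kij})$ has order $m_k\times n_k$ with $m_k,n_k\ge 1$, and $m_k,n_k\to\infty$ as $k\to\infty$. Let $\mathcal M\subset[-1,1]$ be the set of all entries of all the $M_k$, and let $f:\mathcal M\to[0,1]$ be a function. For each $k$, let $X_k=(x_{kij})$ be a random matrix with entries in $[-1,1]$ and $\mathbb E(X_k)=M_k$; the entry $x_{kij}$ is revealed with probability $f(m_{kij})$ and hidden otherwise, where, for each $k$, the entries of $X_k$ and the events that the various entries are revealed are all jointly independent. Fix $\eta\in(0,1)$. The modified USVT estimator $\hat M_k$ of $M_k$ is defined as follows. For an $m\times n$ matrix $Y$ with singular value decomposition $Y=\sum_i\sigma_iu_iv_i^T$, let $\mathrm{USVT}(Y)$ be the matrix obtained by truncating to $[-1,1]$ the entries of $$\sum_{i\,:\,\sigma_i\ge(2+\eta)\max\{\sqrt m,\sqrt n\}}\sigma_iu_iv_i^T .$$ Let $Y_k$ be the matrix whose $(i,j)$-th entry is $x_{kij}$ if that entry is revealed and $0$ otherwise, and let $P_k$ be the matrix whose $(i,j)$-th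 entry is $1$ if $x_{kij}$ is revealed and $0$ otherwise. Put $\hat Q_k=\mathrm{USVT}(Y_k)$ and $\hat R_k=\mathrm{USVT}(P_k)$, and let $w_{kij}=\hat q_{kij}/\hat r_{kij}$ if $\hat r_{kij}\ne0$ and $w_{kij}=0$ otherwise. Then $\hat M_k=(\hat m_{kij})$ is obtained by truncating the numbers $w_{kij}$ to $[-1,1]$. Suppose that $\sup_k\operatorname{rank}(M_k)<\infty$. Let $\mu_k=\frac1{m_kn_k}\sum_{i,j}\delta_{m_{kij}}$ be the empirical distribution of the entries of $M_k$. Suppose that for every probability measure $\mu$ that is the weak limit of some subsequence of $(\mu_k)_{k\ge1}$ there is an extension of $f$ to a Lipschitz function from $[-1,1]$ into $[0,1]$ (which may depend on $\mu$) that has no zeros in the support of $\mu$. Then $\hat M_k$ is consistent, that is, $$\mathrm{MSE}(\hat M_k):=\mathbb E\Bigl[\frac1{m_kn_k}\sum_{i=1}^{m_k}\sum_{j=1}^{n_k}(\hat m_{kij}-m_{kij})^2\Bigr]\longrightarrow0\qquad(k\to\infty).$$ -/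

import Mathlib

open MeasureTheory ProbabilityTheory Filter Set
open scoped Topology ENNReal

/-! ### Singular value decomposition of a real matrix -/

section SVD

variable {m n : ℕ}

/-- The `j`-th singular value `σ_j` of `Y` (in decreasing order, `0 ≤ j < n`, padded with zeros). -/
noncomputable def singVal (Y : Matrix (Fin m) (Fin n) ℝ) (j : Fin n) : ℝ :=
  (Matrix.toEuclideanLin Y).singularValues j

/-- The right singular vectors `v_j` of `Y`: an orthonormal eigenbasis of `Yᵀ Y`, where `v_j`
belongs to the eigenvalue `σ_j ^ 2`. -/
noncomputable def rightSingVec (Y : Matrix (Fin m) (Fin n) ℝ) :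
    OrthonormalBasis (Fin n) ℝ (EuclideanSpace ℝ (Fin n)) :=
  (Matrix.toEuclideanLin Y).isSymmetric_adjoint_comp_self.eigenvectorBasis
    finrank_euclideanSpace_fin

/-- The left singular vectors `u_j = σ_j⁻¹ Y v_j` of `Y` (equal to `0` when `σ_j = 0`). -/
noncomputable def leftSingVec (Y : Matrix (Fin m) (Fin n) ℝ) (j : Fin n) :
    EuclideanSpace ℝ (Fin m) :=
  (singVal Y j)⁻¹ • Matrix.toEuclideanLin Y (rightSingVec Y j)

/-- The rank-one matrix `u vᵀ`. -/
def outerProd (u : EuclideanSpace ℝ (Fin m)) (v : EuclideanSpace ℝ (Fin n)) :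
    Matrix (Fin m) (Fin n) ℝ :=
  Matrix.of fun i j => u i * v j

open Classical in
/-- Singular value thresholding: keep the terms `σ_j u_j v_jᵀ` of the singular value decomposition
of `Y` with `σ_j ≥ t`. -/
noncomputable def svThreshold (t : ℝ) (Y : Matrix (Fin m) (Fin n) ℝ) :
    Matrix (Fin m) (Fin n) ℝ :=
  ∑ j with t ≤ singVal Y j, singVal Y j • outerProd (leftSingVec Y j) (rightSingVec Y j)

/-- `⟪Y v_i, Y v_j⟫ = σ_j ^ 2` if `i = j`, and `0` otherwise. -/
theorem inner_toEuclideanLin_rightSingVec (Y : Matrix (Fin m) (Fin n) ℝ) (i j : Fin n) :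
    inner ℝ (Matrix.toEuclideanLin Y (rightSingVec Y i))
      (Matrix.toEuclideanLin Y (rightSingVec Y j)) = if i = j then singVal Y j ^ 2 else 0 := by
  have h := (Matrix.toEuclideanLin Y).isSymmetric_adjoint_comp_self.apply_eigenvectorBasis
    (finrank_euclideanSpace_fin (𝕜 := ℝ) (n := n)) j
  rw [← LinearMap.adjoint_inner_right]
  change inner ℝ (rightSingVec Y i)
    ((LinearMap.adjoint (Matrix.toEuclideanLin Y) ∘ₗ Matrix.toEuclideanLin Y)
      (rightSingVec Y j)) = _
  have h' : (LinearMap.adjoint (Matrix.toEuclideanLin Y) ∘ₗ Matrix.toEuclideanLin Y)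
      (rightSingVec Y j) = (singVal Y j ^ 2) • rightSingVec Y j := by
    rw [singVal, LinearMap.sq_singularValues_fin _ (finrank_euclideanSpace_fin (𝕜 := ℝ) (n := n))]
    exact h
  rw [h', inner_smul_right, OrthonormalBasis.inner_eq_ite]
  simp

/-- The left singular vectors that belong to nonzero singular values are orthonormal. -/
theorem orthonormal_leftSingVec (Y : Matrix (Fin m) (Fin n) ℝ) :
    Orthonormal ℝ (fun j : {j : Fin n // singVal Y j ≠ 0} => leftSingVec Y j) := by
  rw [orthonormal_iff_ite]
  rintro ⟨i, hi⟩ ⟨j, hj⟩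
  simp only [leftSingVec, inner_smul_left, inner_smul_right, inner_toEuclideanLin_rightSingVec,
    Subtype.mk.injEq]
  split_ifs with h
  · subst h
    simp
    field_simp
  · simp

/-- The singular value decomposition `Y = ∑ σ_j u_j v_jᵀ`. -/
theorem sum_singVal_smul_outerProd (Y : Matrix (Fin m) (Fin n) ℝ) :
    ∑ j, singVal Y j • outerProd (leftSingVec Y j) (rightSingVec Y j) = Y := by
  have key : ∀ j, singVal Y j • leftSingVec Y j
      = Matrix.toEuclideanLin Y (rightSingVec Y j) := by
    intro j
    by_cases hj : singVal Y j = 0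
    · have h := inner_toEuclideanLin_rightSingVec Y j j
      rw [if_pos rfl, hj, zero_pow two_ne_zero, inner_self_eq_zero] at h
      rw [hj, zero_smul, h]
    · rw [leftSingVec, smul_smul, mul_inv_cancel₀ hj, one_smul]
  ext a b
  have hb := (rightSingVec Y).sum_repr' (EuclideanSpace.single b (1 : ℝ))
  have h2 := congrArg (fun w => (Matrix.toEuclideanLin Y w) a) hb
  simp only [map_sum, map_smul, ← key] at h2
  simp [Matrix.toLpLin_apply, EuclideanSpace.inner_single_right] at h2
  rw [Matrix.sum_apply, ← h2]
  refine Finset.sum_congr rfl fun j _ => ?_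
  simp [outerProd]
  ring

end SVD

/-! ### The modified USVT estimator -/

section Estimator

variable {m n : ℕ}

/-- Truncation of a real number to `[-1, 1]`. -/
def trunc (x : ℝ) : ℝ := max (-1) (min 1 x)

/-- The USVT estimate with parameter `η` built from the matrix `Y`: threshold the singular values
at `(2 + η) max {√m, √n}`, then truncate the entries to `[-1, 1]`. -/
noncomputable def usvt (η : ℝ) (Y : Matrix (Fin m) (Fin n) ℝ) : Matrix (Fin m) (Fin n) ℝ :=
  (svThreshold ((2 + η) * max √(m : ℝ) √(n : ℝ)) Y).map trunc

/-- The modified USVT estimate from the zero-filled matrix `Y` and the indicator matrix `P` of the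
revealed entries. Division by `0` gives `0`, as the definition of the estimator prescribes. -/
noncomputable def modifiedUSVT (η : ℝ) (Y P : Matrix (Fin m) (Fin n) ℝ) :
    Matrix (Fin m) (Fin n) ℝ :=
  Matrix.of fun i j => trunc (usvt η Y i j / usvt η P i j)

end Estimator

/-! ### The observation model -/

section Model

variable {m n : ℕ} {Ω : Type*}

/-- The indicator matrix of the revealed entries; `S i j` is the event that the entry `(i, j)` is
revealed. -/
noncomputable def revealMatrix (S : Fin m → Fin n → Set Ω) (ω : Ω) : Matrix (Fin m) (Fin n) ℝ :=
  Matrix.of fun i j => (S i j).indicator 1 ω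

/-- The observed matrix, with the unrevealed entries replaced by `0`. -/
noncomputable def zeroFilled (X : Fin m → Fin n → Ω → ℝ) (S : Fin m → Fin n → Set Ω) (ω : Ω) :
    Matrix (Fin m) (Fin n) ℝ :=
  Matrix.of fun i j => (S i j).indicator (X i j) ω

/-- The random matrix `X` is a noisy version of `M` with entries in `[-1, 1]` and mean `M`, the
entry `(i, j)` is revealed (the event `S i j`) with probability `p i j`, and all the entries of `X`
and all the revelation events are jointly independent. -/
structure IsNoisyObservation [MeasurableSpace Ω] (μ : Measure Ω) (M p : Matrix (Fin m) (Fin n) ℝ)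
    (X : Fin m → Fin n → Ω → ℝ) (S : Fin m → Fin n → Set Ω) : Prop where
  measurable_entry : ∀ i j, Measurable (X i j)
  entry_mem : ∀ i j, ∀ᵐ ω ∂μ, X i j ω ∈ Icc (-1 : ℝ) 1
  integral_entry : ∀ i j, ∫ ω, X i j ω ∂μ = M i j
  measurableSet_reveal : ∀ i j, MeasurableSet (S i j)
  prob_reveal : ∀ i j, μ.real (S i j) = p i j
  indep : iIndepFun (Sum.elim (fun a : Fin m × Fin n => X a.1 a.2)
    (fun a : Fin m × Fin n => (S a.1 a.2).indicator (1 : Ω → ℝ))) μ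

/-- `(1 / (m n)) ∑ (A_ij - M_ij)²`. -/
noncomputable def avgSqError (M A : Matrix (Fin m) (Fin n) ℝ) : ℝ :=
  1 / ((m : ℝ) * n) * ∑ i, ∑ j, (A i j - M i j) ^ 2

/-- The mean squared error of the estimator `Mhat` of `M`. -/
noncomputable def mse [MeasurableSpace Ω] (μ : Measure Ω) (M : Matrix (Fin m) (Fin n) ℝ)
    (Mhat : Ω → Matrix (Fin m) (Fin n) ℝ) : ℝ :=
  ∫ ω, avgSqError M (Mhat ω) ∂μ

/-- The empirical distribution of the entries of a (nonempty) matrix. -/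
noncomputable def empiricalDist [NeZero m] [NeZero n] (M : Matrix (Fin m) (Fin n) ℝ) :
    ProbabilityMeasure ℝ :=
  ⟨((m : ℝ≥0∞) * n)⁻¹ • ∑ i, ∑ j, Measure.dirac (M i j), ⟨by
    simp only [Measure.smul_apply, Measure.finsetSum_apply, measure_univ, Finset.sum_const,
      Finset.card_univ, Fintype.card_fin, nsmul_eq_mul, mul_one, smul_eq_mul]
    exact ENNReal.inv_mul_cancel (by simp [NeZero.ne]) (by finiteness)⟩⟩

/-- The set of all entries of all the matrices of a sequence. -/
def entrySet {m n : ℕ → ℕ} (M : ∀ k, Matrix (Fin (m k)) (Fin (n k)) ℝ) : Set ℝ :=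
  {x | ∃ k i j, M k i j = x}

/-- `μ` is the weak limit of some subsequence of `ν`. -/
def IsSubseqWeakLimit (ν : ℕ → ProbabilityMeasure ℝ) (μ : ProbabilityMeasure ℝ) : Prop :=
  ∃ φ : ℕ → ℕ, StrictMono φ ∧ Tendsto (fun l => ν (φ l)) atTop (𝓝 μ)

end Model

/-! If `g` extends `f`, the zero-filled matrix and the matrix of revealed positions have as means
the matrices obtained from `M k` by applying `x * g x` and `g` to every entry. Once USVT recovers
both means in mean square, their quotient recovers `x` wherever `g x > δ` (`trunc_div_sub_sq_le`).
The entries with `g x ≤ δ` are a small fraction: that sublevel set is closed in `[-1, 1]`, so its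
empirical mass is controlled by its mass under a weak limit, which is small for small `δ` because
`g` has no zeros on the support (`exists_pos_measure_sublevel_lt`). Compactness of the probability
measures on `[-1, 1]` provides such limits along subsequences, which suffices.

For the recovery, a continuous function is uniformly close to a polynomial, and an entrywise
polynomial of matrices of bounded rank has bounded rank (`Matrix.rank_map_polynomial_le`). So the
data have the form `L + E + A`: bounded rank, uniformly small, and independent centred noise. No
operator norm bound for `A` is needed. With `N = max m n`, the moment method bounds the expected
trace of `(AᵀA) ^ p`, for fixed `p`, by `4 ^ p (1 + C_p / N) m n N ^ (p - 1)`
(`IsCentredNoise.integral_trace_pow_le`). The trace is a sum over closed walks; walks that use an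
edge only once contribute nothing, tree-like walks are counted by `4 ^ p m n N ^ (p - 1)`, and the
remaining ones are fewer by a factor `N`.

Normalising at the level `(2 + η / 2) √N` leaves `(4 / (2 + η / 2) ^ 2) ^ p`, which is small for
large `p`: few directions see noise above that level. Linear algebra converts this into a bound on
the number of retained singular values (`numLarge_le`) and then on the Frobenius error
(`frobSq_svThreshold_sub_le`). -/

/-! ### Closed walks in which every edge is repeated -/

section Pattern

/-- The edge traversed at step `t`. The vertices of a walk are named by their first visiting time:
`τ t` is the time of the first visit to the vertex occupied at time `t`. -/
def patternEdge (τ : ℕ → ℕ) (t : ℕ) : Sym2 ℕ := s(τ t, τ (t + 1))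

/-- `τ` records the first visiting times of a closed walk of length `l` that traverses each of its
edges at least twice. -/
structure IsRepeatingPattern (l : ℕ) (τ : ℕ → ℕ) : Prop where
  le_self : ∀ t ≤ l, τ t ≤ t
  closed : τ l = 0
  exists_ne : ∀ t < l, ∃ s < l, s ≠ t ∧ patternEdge τ s = patternEdge τ t

/-- The steps that lead to a new vertex. -/
def newSteps (l : ℕ) (τ : ℕ → ℕ) : Finset ℕ := {t ∈ Finset.range l | τ (t + 1) = t + 1}

/-- The steps that lead to a vertex visited before. -/
def oldSteps (l : ℕ) (τ : ℕ → ℕ) : Finset ℕ := {t ∈ Finset.range l | ¬ τ (t + 1) = t + 1}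

theorem card_newSteps_add_card_oldSteps (l : ℕ) (τ : ℕ → ℕ) :
    (newSteps l τ).card + (oldSteps l τ).card = l := by
  rw [newSteps, oldSteps, Finset.card_filter_add_card_filter_not, Finset.card_range]

variable {l : ℕ} {τ : ℕ → ℕ}

theorem mem_newSteps {t : ℕ} : t ∈ newSteps l τ ↔ t < l ∧ τ (t + 1) = t + 1 := by
  simp [newSteps]

theorem mem_oldSteps {t : ℕ} : t ∈ oldSteps l τ ↔ t < l ∧ ¬ τ (t + 1) = t + 1 := by
  simp [oldSteps]

namespace IsRepeatingPattern

/-- A discovered vertex carries the label `t + 1`, larger than the label of the vertex it is reached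
from, so the larger endpoint of the edge reveals the step. -/
theorem patternEdge_injOn (h : IsRepeatingPattern l τ) :
    Set.InjOn (patternEdge τ) (newSteps l τ) := by
  intro s hs t ht hst
  rw [Finset.mem_coe, mem_newSteps] at hs ht
  have h1 := h.le_self s hs.1.le
  have h2 := h.le_self t ht.1.le
  rw [patternEdge, patternEdge, Sym2.eq_iff, hs.2, ht.2] at hst
  omega

theorem exists_partner (h : IsRepeatingPattern l τ) {t : ℕ} (ht : t ∈ newSteps l τ) :
    ∃ s ∈ oldSteps l τ, patternEdge τ s = patternEdge τ t := by
  obtain ⟨s, hs, hne, he⟩ := h.exists_ne t (mem_newSteps.1 ht).1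
  refine ⟨s, mem_oldSteps.2 ⟨hs, fun hn => hne ?_⟩, he⟩
  exact h.patternEdge_injOn (mem_newSteps.2 ⟨hs, hn⟩) ht he

/-- The old step at which the edge of a new step is traversed again. -/
noncomputable def partner (h : IsRepeatingPattern l τ) (t : newSteps l τ) : oldSteps l τ :=
  ⟨(h.exists_partner t.2).choose, (h.exists_partner t.2).choose_spec.1⟩

theorem patternEdge_partner (h : IsRepeatingPattern l τ) (t : newSteps l τ) :
    patternEdge τ (h.partner t) = patternEdge τ t :=
  (h.exists_partner t.2).choose_spec.2

theorem partner_injective (h : IsRepeatingPattern l τ) : Function.Injective h.partner := by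
  intro s t hst
  apply Subtype.ext
  apply h.patternEdge_injOn s.2 t.2
  rw [← h.patternEdge_partner, ← h.patternEdge_partner, hst]

/-- Repeating each discovered edge costs a separate old step. Equality, when new and old steps are
matched perfectly, is the tree-like case. -/
theorem two_mul_card_newSteps_le (h : IsRepeatingPattern l τ) : 2 * (newSteps l τ).card ≤ l := by
  have h1 := Fintype.card_le_of_injective _ h.partner_injective
  simp only [Fintype.card_coe] at h1
  have := card_newSteps_add_card_oldSteps l τ
  omega

theorem partner_surjective (h : IsRepeatingPattern l τ) (hc : 2 * (newSteps l τ).card = l) :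
    Function.Surjective h.partner := by
  have h1 : Function.Bijective h.partner := by
    rw [Fintype.bijective_iff_injective_and_card]
    refine ⟨h.partner_injective, ?_⟩
    simp only [Fintype.card_coe]
    have := card_newSteps_add_card_oldSteps l τ
    omega
  exact h1.2

/-- In a tree-like walk the edge of an old step is that of exactly one other step, a new one. -/
theorem exists_new_of_old (h : IsRepeatingPattern l τ) (hc : 2 * (newSteps l τ).card = l)
    {s : ℕ} (hs : s ∈ oldSteps l τ) :
    ∃ t ∈ newSteps l τ, patternEdge τ s = patternEdge τ t ∧
      ∀ r < l, patternEdge τ r = patternEdge τ t → r = s ∨ r = t := by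
  obtain ⟨t, ht⟩ := h.partner_surjective hc ⟨s, hs⟩
  refine ⟨t, t.2, ?_, fun r hr he => ?_⟩
  · rw [← h.patternEdge_partner t, ht]
  · by_cases hn : τ (r + 1) = r + 1
    · exact Or.inr (h.patternEdge_injOn (mem_newSteps.2 ⟨hr, hn⟩) t.2 he)
    · obtain ⟨t', ht'⟩ := h.partner_surjective hc ⟨r, mem_oldSteps.2 ⟨hr, hn⟩⟩
      have h2 : t' = t := by
        apply Subtype.ext
        apply h.patternEdge_injOn t'.2 t.2
        rw [← he, ← h.patternEdge_partner t', ht']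
      rw [h2, ht] at ht'
      exact Or.inl (congrArg Subtype.val ht').symm

open Classical in
/-- The vertices that are separated from the root by the edge discovered at step `t`. -/
noncomputable def below (τ : ℕ → ℕ) (t : ℕ) (v : ℕ) : ℤ :=
  -- The vertex `v` is discovered at step `v - 1` from its parent `τ (v - 1)` and lies on the same
  -- side as that parent. The guard `τ (v - 1) < v` serves termination; it holds for the labels of a
  -- repeating pattern.
  if v ≤ t then 0 else if v = t + 1 then 1 else if τ (v - 1) < v then below τ t (τ (v - 1)) else 0
termination_by v

theorem below_of_le {t v : ℕ} (hv : v ≤ t) : below τ t v = 0 := by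
  rw [below, if_pos hv]

theorem below_succ (t : ℕ) : below τ t (t + 1) = 1 := by
  rw [below, if_neg (by omega), if_pos rfl]

theorem below_new (h : IsRepeatingPattern l τ) {r t : ℕ} (hr : r ∈ newSteps l τ) (hrt : r ≠ t) :
    below τ t (τ r) = below τ t (τ (r + 1)) := by
  rw [mem_newSteps] at hr
  have h1 := h.le_self r hr.1.le
  rw [hr.2]
  rcases lt_or_gt_of_ne hrt with h2 | h2
  · rw [below_of_le (by omega), below_of_le (by omega)]
  · conv_rhs => rw [below, if_neg (by omega), if_neg (by omega), Nat.add_sub_cancel,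
      if_pos (by omega)]

/-- In a tree-like walk an old step leads back to the parent vertex. -/
theorem old_step_eq (h : IsRepeatingPattern l τ) (hc : 2 * (newSteps l τ).card = l)
    {s : ℕ} (hs : s ∈ oldSteps l τ) : τ (s + 1) = τ (τ s - 1) := by
  obtain ⟨t, ht, he, hu⟩ := h.exists_new_of_old hc hs
  have ht' := mem_newSteps.1 ht
  have hs' := mem_oldSteps.1 hs
  have hst : s ≠ t := by rintro rfl; exact hs'.2 ht'.2
  rw [patternEdge, patternEdge, Sym2.eq_iff, ht'.2] at he
  rcases he with ⟨h1, h2⟩ | ⟨h1, h2⟩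
  · exfalso
    -- Suppose the edge were crossed both times in the direction of its discovery. The indicator of
    -- the far side would rise by one at `s` and at `t` and stay constant at all other steps, so its
    -- total change along the closed walk would be 2 instead of 0.
    have hstep : ∀ r ∈ Finset.range l, below τ t (τ (r + 1)) - below τ t (τ r)
        = (if r = s then 1 else 0) + (if r = t then 1 else 0) := by
      intro r hr
      rw [Finset.mem_range] at hr
      have hτt : below τ t (τ t) = 0 := below_of_le (h.le_self t ht'.1.le)
      by_cases hrs : r = s
      · subst hrs
        rw [h1, h2, below_succ, hτt]; simp [hst]
      by_cases hrt : r = t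
      · subst hrt
        rw [ht'.2, below_succ, hτt]; simp [hrs]
      rw [if_neg hrs, if_neg hrt, add_zero, sub_eq_zero]
      by_cases hn : τ (r + 1) = r + 1
      · exact (h.below_new (mem_newSteps.2 ⟨hr, hn⟩) hrt).symm
      · obtain ⟨r', hr', he'', -⟩ := h.exists_new_of_old hc (mem_oldSteps.2 ⟨hr, hn⟩)
        have hr't : r' ≠ t := by
          rintro rfl
          rcases hu r hr he'' with h3 | h3 <;> contradiction
        have h3 := h.below_new hr' hr't
        rw [patternEdge, patternEdge, Sym2.eq_iff] at he''
        rcases he'' with ⟨h4, h5⟩ | ⟨h4, h5⟩ <;> rw [h4, h5, h3]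
    have hsum := Finset.sum_congr rfl hstep
    rw [Finset.sum_range_sub (fun r => below τ t (τ r)), Finset.sum_add_distrib,
      Finset.sum_ite_eq', Finset.sum_ite_eq', if_pos (Finset.mem_range.2 hs'.1),
      if_pos (Finset.mem_range.2 ht'.1), h.closed,
      below_of_le (Nat.zero_le _), below_of_le (by have := h.le_self 0 (Nat.zero_le _); omega)] at hsum
    norm_num at hsum
  · rw [h2, h1, Nat.add_sub_cancel]

/-- A tree-like walk is determined up to relabelling by its new steps. -/
theorem eq_of_newSteps_eq (h : IsRepeatingPattern l τ) (hc : 2 * (newSteps l τ).card = l)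
    {τ' : ℕ → ℕ} (h' : IsRepeatingPattern l τ') (hn : newSteps l τ' = newSteps l τ) :
    ∀ t ≤ l, τ t = τ' t := by
  intro t
  induction t using Nat.strong_induction_on with
  | _ t ih =>
    intro ht
    rcases t with _ | t
    · have := h.le_self 0 ht
      have := h'.le_self 0 ht
      omega
    · by_cases hnew : t ∈ newSteps l τ
      · have hnew' := hnew
        rw [← hn] at hnew'
        rw [(mem_newSteps.1 hnew).2, (mem_newSteps.1 hnew').2]
      · have h1 : t ∈ oldSteps l τ :=
          mem_oldSteps.2 ⟨by omega, fun h2 => hnew (mem_newSteps.2 ⟨by omega, h2⟩)⟩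
        have h1' : t ∈ oldSteps l τ' :=
          mem_oldSteps.2 ⟨by omega, fun h2 => hnew (by rw [← hn]; exact mem_newSteps.2 ⟨by omega, h2⟩)⟩
        have h3 := h.le_self t (by omega)
        rw [h.old_step_eq hc h1, h'.old_step_eq (by rw [hn, hc]) h1', ← ih t (by omega) (by omega)]
        exact ih _ (by omega) (by omega)

end IsRepeatingPattern

end Pattern

section Pattern

/-- New and old steps are in bijection along equal edges, so every edge is used exactly twice. The
expectation of such a walk is therefore a product of variances. -/
theorem IsRepeatingPattern.card_step_class {l : ℕ} {τ : ℕ → ℕ} (h : IsRepeatingPattern l τ)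
    (hc : 2 * (newSteps l τ).card = l) {t : ℕ} (ht : t < l) :
    {s ∈ Finset.range l | patternEdge τ s = patternEdge τ t}.card = 2 := by
  have key : ∀ s ∈ oldSteps l τ,
      {r ∈ Finset.range l | patternEdge τ r = patternEdge τ s}.card = 2 := by
    intro s hs
    obtain ⟨u, hu, he, hall⟩ := h.exists_new_of_old hc hs
    rw [Finset.card_eq_two]
    have hsu : s ≠ u := by
      rintro rfl
      exact (mem_oldSteps.1 hs).2 (mem_newSteps.1 hu).2
    refine ⟨s, u, hsu, ?_⟩
    ext r
    simp only [Finset.mem_filter, Finset.mem_range, Finset.mem_insert, Finset.mem_singleton]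
    constructor
    · rintro ⟨h1, h2⟩
      exact hall r h1 (h2.trans he)
    · rintro (rfl | rfl)
      · exact ⟨(mem_oldSteps.1 hs).1, rfl⟩
      · exact ⟨(mem_newSteps.1 hu).1, he.symm⟩
  by_cases hn : τ (t + 1) = t + 1
  · obtain ⟨s, hs, he⟩ := h.exists_partner (mem_newSteps.2 ⟨ht, hn⟩)
    rw [← he]
    exact key s hs
  · exact key t (mem_oldSteps.2 ⟨ht, hn⟩)

end Pattern

/-! ### First visiting times of a walk -/

section FirstVisit

variable {V : Type*} {l : ℕ}

/-- The position at time `t` of a walk with times `0, …, l`. -/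
def walkAt (w : Fin (l + 1) → V) (t : ℕ) : V := w (Fin.ofNat (l + 1) t)

theorem walkAt_val (w : Fin (l + 1) → V) (i : Fin (l + 1)) : walkAt w i = w i := by
  simp [walkAt]

open Classical in
/-- The time of the first visit to the vertex occupied at time `t`. -/
noncomputable def firstVisit (w : Fin (l + 1) → V) (t : ℕ) : ℕ :=
  Nat.find (⟨t, rfl⟩ : ∃ s, walkAt w s = walkAt w t)

theorem walkAt_firstVisit (w : Fin (l + 1) → V) (t : ℕ) :
    walkAt w (firstVisit w t) = walkAt w t := by
  classical
  exact Nat.find_spec (⟨t, rfl⟩ : ∃ s, walkAt w s = walkAt w t)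

theorem firstVisit_le_of_eq {w : Fin (l + 1) → V} {s t : ℕ} (h : walkAt w s = walkAt w t) :
    firstVisit w t ≤ s := by
  classical
  exact Nat.find_min' _ h

theorem firstVisit_le (w : Fin (l + 1) → V) (t : ℕ) : firstVisit w t ≤ t :=
  firstVisit_le_of_eq rfl

theorem firstVisit_eq_iff {w : Fin (l + 1) → V} {s t : ℕ} :
    firstVisit w s = firstVisit w t ↔ walkAt w s = walkAt w t := by
  constructor
  · intro h
    rw [← walkAt_firstVisit, h, walkAt_firstVisit]
  · intro h
    exact le_antisymm (firstVisit_le_of_eq ((walkAt_firstVisit w t).trans h.symm))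
      (firstVisit_le_of_eq ((walkAt_firstVisit w s).trans h))

theorem patternEdge_firstVisit_eq_iff {w : Fin (l + 1) → V} {s t : ℕ} :
    patternEdge (firstVisit w) s = patternEdge (firstVisit w) t ↔
      s(walkAt w s, walkAt w (s + 1)) = s(walkAt w t, walkAt w (t + 1)) := by
  simp only [patternEdge, Sym2.eq_iff, firstVisit_eq_iff]

theorem isRepeatingPattern_firstVisit {w : Fin (l + 1) → V} (hw : walkAt w l = walkAt w 0)
    (h : ∀ t < l, ∃ s < l, s ≠ t ∧
      s(walkAt w s, walkAt w (s + 1)) = s(walkAt w t, walkAt w (t + 1))) :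
    IsRepeatingPattern l (firstVisit w) where
  le_self t _ := firstVisit_le w t
  closed := by
    have := firstVisit_le_of_eq hw.symm
    omega
  exists_ne t ht := by
    obtain ⟨s, hs, hne, he⟩ := h t ht
    exact ⟨s, hs, hne, patternEdge_firstVisit_eq_iff.2 he⟩

/-- The pattern sends each time back to a first visit, which is either time 0 or the end of a new
step; the vertices there determine the whole walk. -/
theorem eq_of_firstVisit_eq {w w' : Fin (l + 1) → V}
    (h : ∀ t ≤ l, firstVisit w t = firstVisit w' t) (h0 : walkAt w 0 = walkAt w' 0)
    (hn : ∀ t ∈ newSteps l (firstVisit w), walkAt w (t + 1) = walkAt w' (t + 1)) : w = w' := by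
  funext i
  rw [← walkAt_val w, ← walkAt_val w']
  have hi : (i : ℕ) ≤ l := Nat.lt_succ_iff.1 i.2
  rw [← walkAt_firstVisit w, ← walkAt_firstVisit w', ← h i hi]
  rcases Nat.eq_zero_or_pos (firstVisit w i) with h1 | h1
  · rw [h1, h0]
  · obtain ⟨t, ht⟩ := Nat.exists_eq_succ_of_ne_zero h1.ne'
    have h2 := firstVisit_le w i
    rw [ht]
    apply hn
    rw [mem_newSteps]
    refine ⟨by omega, ?_⟩
    rw [← Nat.succ_eq_add_one, ← ht]
    exact firstVisit_eq_iff.2 (walkAt_firstVisit w i)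

end FirstVisit

/-! ### Closed walks in a complete bipartite graph -/

section BipartiteWalk

variable {m n l : ℕ}

open Classical in
/-- The closed walks of length `l` in the complete bipartite graph that start on the right. -/
noncomputable def bipartiteWalks (m n l : ℕ) : Finset (Fin (l + 1) → Fin m ⊕ Fin n) :=
  {w | walkAt w l = walkAt w 0 ∧ (walkAt w 0).isRight ∧
    ∀ t < l, (walkAt w t).isRight ≠ (walkAt w (t + 1)).isRight}

theorem mem_bipartiteWalks {w : Fin (l + 1) → Fin m ⊕ Fin n} :
    w ∈ bipartiteWalks m n l ↔ walkAt w l = walkAt w 0 ∧ (walkAt w 0).isRight ∧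
      ∀ t < l, (walkAt w t).isRight ≠ (walkAt w (t + 1)).isRight := by
  simp [bipartiteWalks]

theorem isRight_walkAt {w : Fin (l + 1) → Fin m ⊕ Fin n} (hw : w ∈ bipartiteWalks m n l) :
    ∀ t ≤ l, ((walkAt w t).isRight = true ↔ Even t) := by
  rw [mem_bipartiteWalks] at hw
  intro t
  induction t with
  | zero => simp [hw.2.1]
  | succ t ih =>
    intro ht
    have h1 := hw.2.2 t (by omega)
    have h2 := ih (by omega)
    rw [Nat.even_add_one, ← h2]
    cases h3 : (walkAt w t).isRight <;> cases h4 : (walkAt w (t + 1)).isRight <;> simp_all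

theorem exists_edge_of_bipartite {w : Fin (l + 1) → Fin m ⊕ Fin n} (hl : 0 < l)
    (hw : w ∈ bipartiteWalks m n l) : ∃ ε : ℕ → Fin m × Fin n, ∀ t < l,
      s(walkAt w t, walkAt w (t + 1)) = s(Sum.inl (ε t).1, Sum.inr (ε t).2) := by
  have h : ∀ t, t < l → ∃ e : Fin m × Fin n,
      s(walkAt w t, walkAt w (t + 1)) = s(Sum.inl e.1, Sum.inr e.2) := by
    rw [mem_bipartiteWalks] at hw
    intro t ht
    have h1 := hw.2.2 t ht
    cases h2 : walkAt w t <;> cases h3 : walkAt w (t + 1) <;> simp_all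
  -- A default edge for the times `t ≥ l`, available because the walk has at least one step.
  obtain ⟨e₀, -⟩ := h 0 hl
  have h' : ∀ t, ∃ e : Fin m × Fin n, t < l →
      s(walkAt w t, walkAt w (t + 1)) = s(Sum.inl e.1, Sum.inr e.2) := fun t =>
    if ht : t < l then (h t ht).imp fun _ he _ => he else ⟨e₀, fun h => absurd h ht⟩
  choose ε hε using h'
  exact ⟨ε, hε⟩

/-- The first step changes sides, so it cannot stay at the starting vertex. -/
theorem zero_mem_newSteps {w : Fin (l + 1) → Fin m ⊕ Fin n} (hl : 0 < l)
    (hw : w ∈ bipartiteWalks m n l) : 0 ∈ newSteps l (firstVisit w) := by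
  rw [mem_newSteps]
  refine ⟨hl, ?_⟩
  have h1 := firstVisit_le w (0 + 1)
  have h2 := walkAt_firstVisit w (0 + 1)
  rw [mem_bipartiteWalks] at hw
  have h3 := hw.2.2 0 hl
  by_contra h4
  have h5 : firstVisit w (0 + 1) = 0 := by omega
  rw [h5] at h2
  rw [h2] at h3
  exact h3 rfl

/-- The number of bipartite closed walks with a given pattern. -/
theorem card_le_of_firstVisit_eq (hl : 0 < l) (F : Finset (Fin (l + 1) → Fin m ⊕ Fin n))
    (hF : F ⊆ bipartiteWalks m n l)
    (h : ∀ w ∈ F, ∀ w' ∈ F, ∀ t ≤ l, firstVisit w t = firstVisit w' t) (a : ℕ)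
    (ha : ∀ w ∈ F, (newSteps l (firstVisit w)).card ≤ a + 1) (hmn : 0 < max m n) :
    F.card ≤ m * n * max m n ^ a := by
  classical
  rcases F.eq_empty_or_nonempty with rfl | ⟨w₀, hw₀⟩
  · simp
  set T := newSteps l (firstVisit w₀) with hT
  have h0T : 0 ∈ T := zero_mem_newSteps hl (hF hw₀)
  have hTw : ∀ w ∈ F, newSteps l (firstVisit w) = T := by
    intro w hw
    ext t
    rw [hT, mem_newSteps, mem_newSteps]
    refine and_congr_right fun ht => ?_
    rw [h w hw w₀ hw₀ (t + 1) ht]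
  let side : ℕ → Finset (Fin m ⊕ Fin n) := fun t =>
    if Even t then Finset.univ.map ⟨Sum.inr, Sum.inr_injective⟩
    else Finset.univ.map ⟨Sum.inl, Sum.inl_injective⟩
  have hside : ∀ w ∈ F, ∀ t ≤ l, walkAt w t ∈ side t := by
    intro w hw t ht
    have h1 := isRight_walkAt (hF hw) t ht
    simp only [side]
    split_ifs with h2
    · obtain ⟨j, hj⟩ := Sum.isRight_iff.1 (h1.2 h2)
      simp [hj]
    · cases h3 : walkAt w t with
      | inl i => simp
      | inr j => exact absurd (h1.1 (by rw [h3]; rfl)) h2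
  have hcard : ∀ t, (side t).card ≤ max m n := by
    intro t
    simp only [side]
    split_ifs <;> simp
  -- Encode a walk by its start, with `n` choices, and its discovered vertices. The one discovered
  -- at step 0 has `m` choices and each of the others, at most `a` in number, has at most `max m n`.
  have hinj : F.card ≤ (side 0 ×ˢ Finset.pi T (fun t => side (t + 1))).card := by
    apply Finset.card_le_card_of_injOn (fun w => (walkAt w 0, fun t _ => walkAt w (t + 1)))
    · intro w hw
      simp only [Finset.mem_coe, Finset.mem_product, Finset.mem_pi]
      exact ⟨hside w hw 0 (Nat.zero_le _), fun t ht => hside w hw _ (mem_newSteps.1 ht).1⟩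
    · intro w hw w' hw' he
      simp only [Prod.mk.injEq] at he
      refine eq_of_firstVisit_eq (h w hw w' hw') he.1 fun t ht => ?_
      rw [hTw w hw] at ht
      exact congrFun (congrFun he.2 t) ht
  refine hinj.trans ?_
  rw [Finset.card_product, Finset.card_pi, ← Finset.mul_prod_erase T _ h0T]
  have h1 : (side 0).card = n := by simp [side]
  have h2 : (side (0 + 1)).card = m := by simp [side]
  rw [h1, h2, ← mul_assoc, mul_comm n m]
  refine Nat.mul_le_mul_left _ ((Finset.prod_le_pow_card _ _ _ fun t _ => hcard _).trans ?_)
  refine Nat.pow_le_pow_right hmn ?_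
  rw [Finset.card_erase_of_mem h0T]
  have := ha w₀ hw₀
  rw [← hT] at this
  omega

open Classical in
/-- The number of tree-like bipartite closed walks. -/
theorem card_treeLike_le {p : ℕ} (hp : 0 < p) (hmn : 0 < max m n) :
    {w ∈ bipartiteWalks m n (2 * p) | IsRepeatingPattern (2 * p) (firstVisit w) ∧
      (newSteps (2 * p) (firstVisit w)).card = p}.card ≤
      4 ^ p * (m * n * max m n ^ (p - 1)) := by
  set R := {w ∈ bipartiteWalks m n (2 * p) | IsRepeatingPattern (2 * p) (firstVisit w) ∧
      (newSteps (2 * p) (firstVisit w)).card = p} with hR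
  -- A tree-like pattern is determined by its set of new steps, a subset of `2 * p` times, which
  -- gives `2 ^ (2 * p) = 4 ^ p`. This base 4 is why the threshold is just above `2 √N`.
  have h1 : (R.image fun w => newSteps (2 * p) (firstVisit w)).card ≤ 4 ^ p := by
    have : (R.image fun w => newSteps (2 * p) (firstVisit w)) ⊆
        (Finset.range (2 * p)).powerset := by
      intro T hT
      obtain ⟨w, -, rfl⟩ := Finset.mem_image.1 hT
      rw [Finset.mem_powerset]
      exact Finset.filter_subset _ _
    refine (Finset.card_le_card this).trans ?_
    rw [Finset.card_powerset, Finset.card_range, pow_mul]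
    norm_num
  refine (Finset.card_le_mul_card_image (f := fun w => newSteps (2 * p) (firstVisit w)) R
    (m * n * max m n ^ (p - 1)) ?_).trans ?_
  · intro T hT
    apply card_le_of_firstVisit_eq (by omega)
    · intro w hw
      simp only [hR, Finset.mem_filter] at hw
      exact hw.1.1
    · intro w hw w' hw'
      simp only [hR, Finset.mem_filter] at hw hw'
      exact hw.1.2.1.eq_of_newSteps_eq (by rw [hw.1.2.2]) hw'.1.2.1 (by rw [hw.2, hw'.2])
    · intro w hw
      simp only [hR, Finset.mem_filter] at hw
      omega
    · exact hmn
  · rw [mul_comm]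
    exact Nat.mul_le_mul_right _ h1

open Classical in
/-- The number of bipartite closed walks that repeat every edge and are not tree-like. -/
theorem card_not_treeLike_le {p : ℕ} (hp : 0 < p) (hmn : 0 < max m n) :
    max m n * {w ∈ bipartiteWalks m n (2 * p) | IsRepeatingPattern (2 * p) (firstVisit w) ∧
      (newSteps (2 * p) (firstVisit w)).card ≠ p}.card ≤
      (2 * p + 1) ^ (2 * p + 1) * (m * n * max m n ^ (p - 1)) := by
  set R := {w ∈ bipartiteWalks m n (2 * p) | IsRepeatingPattern (2 * p) (firstVisit w) ∧
      (newSteps (2 * p) (firstVisit w)).card ≠ p} with hR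
  rcases R.eq_empty_or_nonempty with he | ⟨w₀, hw₀⟩
  · rw [he]; simp
  have hmem : ∀ w ∈ R, w ∈ bipartiteWalks m n (2 * p) ∧
      (newSteps (2 * p) (firstVisit w)).card < p := by
    intro w hw
    simp only [hR, Finset.mem_filter] at hw
    have := hw.2.1.two_mul_card_newSteps_le
    exact ⟨hw.1, by omega⟩
  -- Step 0 is new and fewer than `p` steps are, so the exponent `p - 2` below is a true
  -- subtraction.
  have hp2 : 2 ≤ p := by
    have h1 := zero_mem_newSteps (by omega) (hmem w₀ hw₀).1
    have h2 := Finset.card_pos.2 ⟨_, h1⟩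
    have := (hmem w₀ hw₀).2
    omega
  -- A crude count of patterns suffices, since it depends on `p` alone: one discovered vertex fewer
  -- saves a factor `max m n`.
  let κ : (Fin (2 * p + 1) → Fin m ⊕ Fin n) → (Fin (2 * p + 1) → Fin (2 * p + 1)) :=
    fun w i => ⟨firstVisit w i, (firstVisit_le w i).trans_lt i.2⟩
  have h1 : (R.image κ).card ≤ (2 * p + 1) ^ (2 * p + 1) := by
    refine (Finset.card_le_univ _).trans ?_
    simp
  have h2 : R.card ≤ m * n * max m n ^ (p - 2) * (R.image κ).card := by
    refine Finset.card_le_mul_card_image (f := κ) R _ fun σ _ => ?_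
    apply card_le_of_firstVisit_eq (by omega)
    · intro w hw
      exact (hmem w (Finset.mem_filter.1 hw).1).1
    · intro w hw w' hw' t ht
      have h3 : κ w = κ w' :=
        (Finset.mem_filter.1 hw).2.trans (Finset.mem_filter.1 hw').2.symm
      exact congrArg Fin.val (congrFun h3 ⟨t, Nat.lt_succ_of_le ht⟩)
    · intro w hw
      have := (hmem w (Finset.mem_filter.1 hw).1).2
      omega
    · exact hmn
  calc max m n * R.card ≤ max m n * (m * n * max m n ^ (p - 2) * (2 * p + 1) ^ (2 * p + 1)) :=
        Nat.mul_le_mul_left _ (h2.trans (Nat.mul_le_mul_left _ h1))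
    _ = (2 * p + 1) ^ (2 * p + 1) * (m * n * max m n ^ (p - 1)) := by
        obtain ⟨q, rfl⟩ : ∃ q, p = q + 2 := ⟨p - 2, by omega⟩
        simp only [Nat.add_sub_cancel, show q + 2 - 1 = q + 1 by omega]
        ring

end BipartiteWalk

/-! ### Traces of powers as sums over walks -/

section Trace

theorem Matrix.pow_apply_eq_sum_walks {V : Type*} [Fintype V] [DecidableEq V]
    (H : Matrix V V ℝ) (l : ℕ) (u v : V) :
    (H ^ l) u v = ∑ w : Fin (l + 1) → V,
      if w 0 = u ∧ w (Fin.last l) = v then ∏ i : Fin l, H (w i.castSucc) (w i.succ) else 0 := by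
  induction l generalizing u with
  | zero =>
    rw [pow_zero, Matrix.one_apply, ← (Equiv.funUnique (Fin 1) V).symm.sum_comp]
    simp only [Equiv.funUnique_symm_apply, uniqueElim_const, Finset.univ_eq_empty,
      Finset.prod_empty]
    by_cases h : u = v
    · subst h
      simp
    · rw [if_neg h]
      symm
      apply Finset.sum_eq_zero
      intro x _
      rw [if_neg]
      rintro ⟨h1, h2⟩
      exact h (h1.symm.trans h2)
  | succ l ih =>
    rw [pow_succ', Matrix.mul_apply, ← (Fin.consEquiv fun _ : Fin (l + 2) => V).sum_comp,
      Fintype.sum_prod_type, eq_comm, Finset.sum_eq_single u]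
    · simp_rw [ih, Finset.mul_sum]
      rw [Finset.sum_comm]
      refine Finset.sum_congr rfl fun w _ => ?_
      rw [eq_comm, Finset.sum_eq_single (w 0)]
      · simp [Fin.consEquiv, Fin.prod_univ_succ, ← Fin.succ_last, mul_ite]
      · intro b _ hb
        simp [hb.symm]
      · simp
    · intro b _ hb
      apply Finset.sum_eq_zero
      intro w _
      simp [Fin.consEquiv, hb]
    · simp

variable {m n : ℕ}

/-- The symmetric matrix with off-diagonal blocks `A` and `Aᵀ`. -/
def hermitization (A : Matrix (Fin m) (Fin n) ℝ) :
    Matrix (Fin m ⊕ Fin n) (Fin m ⊕ Fin n) ℝ :=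
  Matrix.fromBlocks 0 A A.transpose 0

/-- The symmetric block matrix lets both directions of an edge carry the same entry, and its even
powers expose `(AᵀA) ^ p` as a diagonal block. -/
theorem hermitization_pow (A : Matrix (Fin m) (Fin n) ℝ) (p : ℕ) :
    hermitization A ^ (2 * p) =
      Matrix.fromBlocks ((A * A.transpose) ^ p) 0 0 ((A.transpose * A) ^ p) := by
  have h2 : hermitization A ^ 2 =
      Matrix.fromBlocks (A * A.transpose) 0 0 (A.transpose * A) := by
    rw [pow_two, hermitization, Matrix.fromBlocks_multiply]
    simp
  rw [pow_mul, h2]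
  induction p with
  | zero => simp [Matrix.fromBlocks_one]
  | succ p ih => rw [pow_succ, ih, Matrix.fromBlocks_multiply]; simp [pow_succ]

theorem trace_pow_eq_sum_bipartiteWalks (A : Matrix (Fin m) (Fin n) ℝ) (p : ℕ) :
    ((A.transpose * A) ^ p).trace = ∑ w ∈ bipartiteWalks m n (2 * p),
      ∏ t ∈ Finset.range (2 * p), hermitization A (walkAt w t) (walkAt w (t + 1)) := by
  classical
  have h1 : ∀ j, ((A.transpose * A) ^ p) j j = (hermitization A ^ (2 * p)) (.inr j) (.inr j) := by
    intro j
    rw [hermitization_pow, Matrix.fromBlocks_apply₂₂]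
  have hprod : ∀ w : Fin (2 * p + 1) → Fin m ⊕ Fin n,
      ∏ i : Fin (2 * p), hermitization A (w i.castSucc) (w i.succ) =
        ∏ t ∈ Finset.range (2 * p), hermitization A (walkAt w t) (walkAt w (t + 1)) := by
    intro w
    rw [← Fin.prod_univ_eq_prod_range
      (fun t => hermitization A (walkAt w t) (walkAt w (t + 1)))]
    refine Finset.prod_congr rfl fun i _ => ?_
    rw [← walkAt_val w, ← walkAt_val w]
    simp
  simp only [Matrix.trace, Matrix.diag_apply, h1, Matrix.pow_apply_eq_sum_walks, hprod]
  rw [Finset.sum_comm, bipartiteWalks, Finset.sum_filter]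
  refine Finset.sum_congr rfl fun w _ => ?_
  have h0 : w 0 = walkAt w 0 := (walkAt_val w 0).symm
  have hlast : w (Fin.last _) = walkAt w (2 * p) := by
    rw [← walkAt_val w]; simp
  rw [h0, hlast]
  split_ifs with hw
  · obtain ⟨j, hj⟩ := Sum.isRight_iff.1 hw.2.1
    rw [Finset.sum_eq_single j]
    · rw [if_pos ⟨hj, hw.1.trans hj⟩]
    · intro i _ hi
      rw [if_neg]
      rw [hj]
      simp [hi.symm]
    · simp
  · apply Finset.sum_eq_zero
    intro j _
    split_ifs with hj
    -- A closed walk that starts on the right but is not bipartite has a step inside one side, where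
    -- the block is zero.
    · have : ∃ t < 2 * p, (walkAt w t).isRight = (walkAt w (t + 1)).isRight := by
        by_contra hcon
        push Not at hcon
        exact hw ⟨hj.2.trans hj.1.symm, by rw [hj.1]; rfl, hcon⟩
      obtain ⟨t, ht, he⟩ := this
      apply Finset.prod_eq_zero (Finset.mem_range.2 ht)
      cases h2 : walkAt w t <;> cases h3 : walkAt w (t + 1) <;>
        simp_all [hermitization]
    · rfl

theorem hermitization_eq_of_edge (A : Matrix (Fin m) (Fin n) ℝ) {u v : Fin m ⊕ Fin n}
    {e : Fin m × Fin n} (h : s(u, v) = s(Sum.inl e.1, Sum.inr e.2)) :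
    hermitization A u v = A e.1 e.2 := by
  rw [Sym2.eq_iff] at h
  rcases h with ⟨rfl, rfl⟩ | ⟨rfl, rfl⟩ <;> simp [hermitization]

end Trace

/-! ### The expected trace of powers of a random matrix -/

section Moment

variable {Ω : Type*} [MeasurableSpace Ω] {P : Measure Ω}

/-- A family of independent centred random variables, bounded by `2` and with variances at most
`1`. -/
structure IsCentredNoise {E : Type*} (P : Measure Ω) (Z : E → Ω → ℝ) : Prop where
  indep : iIndepFun Z P
  measurable : ∀ e, Measurable (Z e)
  abs_le : ∀ e, ∀ᵐ ω ∂P, |Z e ω| ≤ 2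
  integral_eq : ∀ e, ∫ ω, Z e ω ∂P = 0
  integral_sq_le : ∀ e, ∫ ω, Z e ω ^ 2 ∂P ≤ 1

namespace IsCentredNoise

variable {E : Type*} [Fintype E] [DecidableEq E] {Z : E → Ω → ℝ} (hZ : IsCentredNoise P Z)
include hZ

theorem integral_prod_eq (l : ℕ) (ε : ℕ → E) :
    ∫ ω, ∏ t ∈ Finset.range l, Z (ε t) ω ∂P =
      ∏ e, ∫ ω, Z e ω ^ {t ∈ Finset.range l | ε t = e}.card ∂P := by
  rw [← hZ.indep.integral_fun_prod_comp
    (f := fun e x => x ^ {t ∈ Finset.range l | ε t = e}.card)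
    (fun e => (hZ.measurable e).aemeasurable) (fun e => by fun_prop)]
  congr 1
  funext ω
  rw [← Finset.prod_fiberwise_of_maps_to (g := ε) (t := Finset.univ) (fun _ _ => Finset.mem_univ _)]
  refine Finset.prod_congr rfl fun e _ => ?_
  rw [Finset.prod_congr rfl (g := fun _ => Z e ω), Finset.prod_const]
  intro t ht
  rw [(Finset.mem_filter.1 ht).2]

/-- By independence, a variable that occurs once splits off its mean, which is zero. -/
theorem integral_prod_eq_zero (l : ℕ) (ε : ℕ → E) {t : ℕ} (ht : t < l)
    (h : ∀ s < l, s ≠ t → ε s ≠ ε t) : ∫ ω, ∏ t ∈ Finset.range l, Z (ε t) ω ∂P = 0 := by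
  rw [hZ.integral_prod_eq]
  apply Finset.prod_eq_zero (Finset.mem_univ (ε t))
  have : {s ∈ Finset.range l | ε s = ε t} = {t} := by
    ext s
    simp only [Finset.mem_filter, Finset.mem_range, Finset.mem_singleton]
    constructor
    · rintro ⟨h1, h2⟩
      by_contra h3
      exact h s h1 h3 h2
    · rintro rfl
      exact ⟨ht, rfl⟩
  rw [this]
  simpa using hZ.integral_eq _

omit [Fintype E] [DecidableEq E] in
theorem abs_integral_pow_le (e : E) (c : ℕ) : |∫ ω, Z e ω ^ c ∂P| ≤ 2 ^ c := by
  have := hZ.indep.isProbabilityMeasure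
  have h := norm_integral_le_of_norm_le_const (μ := P) (f := fun ω => Z e ω ^ c) (C := 2 ^ c) (by
    filter_upwards [hZ.abs_le e] with ω hω
    rw [norm_pow, Real.norm_eq_abs]
    gcongr)
  simpa using h

theorem abs_integral_prod_le (l : ℕ) (ε : ℕ → E) :
    |∫ ω, ∏ t ∈ Finset.range l, Z (ε t) ω ∂P| ≤ 2 ^ l := by
  rw [hZ.integral_prod_eq, Finset.abs_prod]
  refine (Finset.prod_le_prod (fun _ _ => abs_nonneg _)
    fun e _ => hZ.abs_integral_pow_le e _).trans_eq ?_
  rw [Finset.prod_pow_eq_pow_sum, ← Finset.card_eq_sum_card_fiberwise (fun _ _ => Finset.mem_univ _),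
    Finset.card_range]

theorem abs_integral_prod_le_one (l : ℕ) (ε : ℕ → E)
    (h : ∀ t < l, {s ∈ Finset.range l | ε s = ε t}.card = 2) :
    |∫ ω, ∏ t ∈ Finset.range l, Z (ε t) ω ∂P| ≤ 1 := by
  have := hZ.indep.isProbabilityMeasure
  rw [hZ.integral_prod_eq, Finset.abs_prod]
  refine Finset.prod_le_one (fun _ _ => abs_nonneg _) fun e _ => ?_
  by_cases he : ∃ t < l, ε t = e
  · obtain ⟨t, ht, rfl⟩ := he
    rw [h t ht, abs_of_nonneg (integral_nonneg fun _ => sq_nonneg _)]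
    exact hZ.integral_sq_le _
  · have : {t ∈ Finset.range l | ε t = e} = ∅ := by
      rw [Finset.filter_eq_empty_iff]
      intro t ht h1
      exact he ⟨t, Finset.mem_range.1 ht, h1⟩
    rw [this]
    simp

omit [DecidableEq E] in
theorem ae_abs_prod_le (l : ℕ) (ε : ℕ → E) :
    ∀ᵐ ω ∂P, |∏ t ∈ Finset.range l, Z (ε t) ω| ≤ 2 ^ l := by
  have h := ae_all_iff.2 hZ.abs_le
  filter_upwards [h] with ω hω
  rw [Finset.abs_prod]
  refine (Finset.prod_le_prod (fun _ _ => abs_nonneg _) fun t _ => hω (ε t)).trans_eq ?_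
  simp

omit [DecidableEq E] in
theorem integrable_prod (l : ℕ) (ε : ℕ → E) :
    Integrable (fun ω => ∏ t ∈ Finset.range l, Z (ε t) ω) P := by
  have := hZ.indep.isProbabilityMeasure
  refine Integrable.of_bound (C := 2 ^ l) ?_ (hZ.ae_abs_prod_le l ε)
  exact (Finset.measurable_fun_prod _ fun t _ => hZ.measurable (ε t)).aestronglyMeasurable

end IsCentredNoise

variable {m n : ℕ} {Z : Fin m × Fin n → Ω → ℝ}

/-- The random matrix with entries `Z (i, j)`. -/
def noiseMatrix (Z : Fin m × Fin n → Ω → ℝ) (ω : Ω) : Matrix (Fin m) (Fin n) ℝ :=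
  Matrix.of fun i j => Z (i, j) ω

open Classical in
/-- The expected trace of `(ZᵀZ) ^ p`. -/
theorem IsCentredNoise.integral_trace_pow_le (hZ : IsCentredNoise P Z) {p : ℕ} (hp : 0 < p)
    (hmn : 0 < max m n) :
    Integrable (fun ω => (((noiseMatrix Z ω).transpose * noiseMatrix Z ω) ^ p).trace) P ∧
    ∫ ω, (((noiseMatrix Z ω).transpose * noiseMatrix Z ω) ^ p).trace ∂P ≤
      4 ^ p * (1 + (2 * p + 1 : ℝ) ^ (2 * p + 1) / (max m n : ℕ)) *
        (m * n * ((max m n : ℕ) : ℝ) ^ (p - 1)) := by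
  have hterm : ∀ w ∈ bipartiteWalks m n (2 * p), ∃ ε : ℕ → Fin m × Fin n,
      (∀ ω, ∏ t ∈ Finset.range (2 * p),
        hermitization (noiseMatrix Z ω) (walkAt w t) (walkAt w (t + 1)) =
          ∏ t ∈ Finset.range (2 * p), Z (ε t) ω) ∧
      ∀ s < 2 * p, ∀ t < 2 * p, ε s = ε t ↔
        s(walkAt w s, walkAt w (s + 1)) = s(walkAt w t, walkAt w (t + 1)) := by
    intro w hw
    obtain ⟨ε, hε⟩ := exists_edge_of_bipartite (by omega) hw
    refine ⟨ε, fun ω => Finset.prod_congr rfl fun t ht => ?_, fun s hs t ht => ?_⟩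
    · rw [hermitization_eq_of_edge _ (hε t (Finset.mem_range.1 ht))]
      rfl
    · rw [hε s hs, hε t ht, Sym2.eq_iff]
      simp [Prod.ext_iff]
  have hint : ∀ w ∈ bipartiteWalks m n (2 * p), Integrable (fun ω =>
      ∏ t ∈ Finset.range (2 * p),
        hermitization (noiseMatrix Z ω) (walkAt w t) (walkAt w (t + 1))) P := by
    intro w hw
    obtain ⟨ε, hε, -⟩ := hterm w hw
    simp_rw [hε]
    exact hZ.integrable_prod _ ε
  simp_rw [trace_pow_eq_sum_bipartiteWalks]
  refine ⟨integrable_finsetSum _ hint, ?_⟩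
  rw [integral_finsetSum _ hint]
  set I : (Fin (2 * p + 1) → Fin m ⊕ Fin n) → ℝ := fun w => ∫ ω, ∏ t ∈ Finset.range (2 * p),
        hermitization (noiseMatrix Z ω) (walkAt w t) (walkAt w (t + 1)) ∂P with hI
  have hzero : ∀ w ∈ bipartiteWalks m n (2 * p), ¬ IsRepeatingPattern (2 * p) (firstVisit w) →
      I w = 0 := by
    intro w hw hnot
    obtain ⟨ε, hε, hε'⟩ := hterm w hw
    simp only [hI, hε]
    have : ∃ t < 2 * p, ∀ s < 2 * p, s ≠ t →
        s(walkAt w s, walkAt w (s + 1)) ≠ s(walkAt w t, walkAt w (t + 1)) := by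
      by_contra hcon
      push Not at hcon
      exact hnot (isRepeatingPattern_firstVisit (mem_bipartiteWalks.1 hw).1 hcon)
    obtain ⟨t, ht, h⟩ := this
    exact hZ.integral_prod_eq_zero _ ε ht fun s hs hst he => h s hs hst ((hε' s hs t ht).1 he)
  have htree : ∀ w ∈ bipartiteWalks m n (2 * p), IsRepeatingPattern (2 * p) (firstVisit w) →
      (newSteps (2 * p) (firstVisit w)).card = p → I w ≤ 1 := by
    intro w hw hrep hc
    obtain ⟨ε, hε, hε'⟩ := hterm w hw
    simp only [hI, hε]
    refine (le_abs_self _).trans (hZ.abs_integral_prod_le_one _ ε fun t ht => ?_)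
    refine Eq.trans (congrArg Finset.card ?_) (hrep.card_step_class (by omega) ht)
    ext s
    simp only [Finset.mem_filter, Finset.mem_range]
    refine and_congr_right fun hs => ?_
    rw [hε' s hs t ht, patternEdge_firstVisit_eq_iff]
  -- The bound 2 on each of the `2 * p` factors gives `4 ^ p`. It is used only for walks that are
  -- not tree-like, whose number compensates for it.
  have hgen : ∀ w ∈ bipartiteWalks m n (2 * p), I w ≤ 4 ^ p := by
    intro w hw
    obtain ⟨ε, hε, -⟩ := hterm w hw
    simp only [hI, hε]
    refine (le_abs_self _).trans ((hZ.abs_integral_prod_le _ ε).trans_eq ?_)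
    rw [pow_mul]
    norm_num
  set R₁ := {w ∈ bipartiteWalks m n (2 * p) | IsRepeatingPattern (2 * p) (firstVisit w) ∧
      (newSteps (2 * p) (firstVisit w)).card = p} with hR₁
  set R₂ := {w ∈ bipartiteWalks m n (2 * p) | IsRepeatingPattern (2 * p) (firstVisit w) ∧
      (newSteps (2 * p) (firstVisit w)).card ≠ p} with hR₂
  have hc₁ : (R₁.card : ℝ) ≤ 4 ^ p * (m * n * ((max m n : ℕ) : ℝ) ^ (p - 1)) := by
    exact_mod_cast card_treeLike_le (m := m) (n := n) hp hmn
  have hN : (0 : ℝ) < (max m n : ℕ) := by exact_mod_cast hmn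
  have hc₂ : (R₂.card : ℝ) ≤ (2 * p + 1 : ℝ) ^ (2 * p + 1) / (max m n : ℕ) *
      (m * n * ((max m n : ℕ) : ℝ) ^ (p - 1)) := by
    have h := card_not_treeLike_le (m := m) (n := n) hp hmn
    rw [div_mul_eq_mul_div, le_div_iff₀ hN, mul_comm]
    exact_mod_cast h
  have hsum : ∑ w ∈ bipartiteWalks m n (2 * p), I w ≤ ∑ w ∈ bipartiteWalks m n (2 * p),
      ((if IsRepeatingPattern (2 * p) (firstVisit w) ∧
        (newSteps (2 * p) (firstVisit w)).card = p then 1 else 0) +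
      (if IsRepeatingPattern (2 * p) (firstVisit w) ∧
        (newSteps (2 * p) (firstVisit w)).card ≠ p then 4 ^ p else 0)) := by
    refine Finset.sum_le_sum fun w hw => ?_
    by_cases h1 : IsRepeatingPattern (2 * p) (firstVisit w)
    · by_cases h2 : (newSteps (2 * p) (firstVisit w)).card = p
      · simpa [h1, h2] using htree w hw h1 h2
      · simpa [h1, h2] using hgen w hw
    · simp [h1, hzero w hw h1]
  refine hsum.trans ?_
  rw [Finset.sum_add_distrib, ← Finset.sum_filter, ← Finset.sum_filter, ← hR₁, ← hR₂,
    Finset.sum_const, Finset.sum_const, nsmul_eq_mul, nsmul_eq_mul, mul_one]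
  calc (R₁.card : ℝ) + R₂.card * 4 ^ p ≤ _ :=
        add_le_add hc₁ (mul_le_mul_of_nonneg_right hc₂ (by positivity))
    _ = _ := by ring

end Moment

/-! ### Linear algebra of singular value thresholding -/

section SVThreshold

variable {m n : ℕ}

theorem singVal_nonneg (Y : Matrix (Fin m) (Fin n) ℝ) (j : Fin n) : 0 ≤ singVal Y j :=
  LinearMap.singularValues_nonneg _ _

theorem norm_sq_sum_smul_toEuclideanLin (Y : Matrix (Fin m) (Fin n) ℝ) (c : Fin n → ℝ) :
    ‖∑ j, c j • Matrix.toEuclideanLin Y (rightSingVec Y j)‖ ^ 2 =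
      ∑ j, c j ^ 2 * singVal Y j ^ 2 := by
  rw [← real_inner_self_eq_norm_sq, sum_inner]
  refine Finset.sum_congr rfl fun i _ => ?_
  rw [inner_sum, Finset.sum_eq_single i]
  · rw [inner_smul_left, inner_smul_right, inner_toEuclideanLin_rightSingVec, if_pos rfl]
    simp
    ring
  · intro j _ hj
    rw [inner_smul_left, inner_smul_right, inner_toEuclideanLin_rightSingVec, if_neg hj.symm]
    simp
  · simp

theorem toEuclideanLin_eq_sum (Y : Matrix (Fin m) (Fin n) ℝ) (x : EuclideanSpace ℝ (Fin n)) :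
    Matrix.toEuclideanLin Y x =
      ∑ j, inner ℝ (rightSingVec Y j) x • Matrix.toEuclideanLin Y (rightSingVec Y j) := by
  conv_lhs => rw [← (rightSingVec Y).sum_repr' x]
  simp only [map_sum, map_smul]

theorem norm_sq_toEuclideanLin (Y : Matrix (Fin m) (Fin n) ℝ) (x : EuclideanSpace ℝ (Fin n)) :
    ‖Matrix.toEuclideanLin Y x‖ ^ 2 =
      ∑ j, inner ℝ (rightSingVec Y j) x ^ 2 * singVal Y j ^ 2 := by
  rw [toEuclideanLin_eq_sum, norm_sq_sum_smul_toEuclideanLin]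

theorem singVal_smul_leftSingVec (Y : Matrix (Fin m) (Fin n) ℝ) (j : Fin n) :
    singVal Y j • leftSingVec Y j = Matrix.toEuclideanLin Y (rightSingVec Y j) := by
  by_cases hj : singVal Y j = 0
  · have h := inner_toEuclideanLin_rightSingVec Y j j
    rw [if_pos rfl, hj, zero_pow two_ne_zero, inner_self_eq_zero] at h
    rw [hj, zero_smul, h]
  · rw [leftSingVec, smul_smul, mul_inv_cancel₀ hj, one_smul]

theorem toEuclideanLin_outerProd (u : EuclideanSpace ℝ (Fin m)) (v x : EuclideanSpace ℝ (Fin n)) :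
    Matrix.toEuclideanLin (outerProd u v) x = inner ℝ v x • u := by
  ext i
  simp [Matrix.toLpLin_apply, outerProd, Matrix.mulVec, dotProduct, PiLp.inner_apply,
    Finset.mul_sum, mul_comm, mul_assoc]

open Classical in
theorem toEuclideanLin_svThreshold (t : ℝ) (Y : Matrix (Fin m) (Fin n) ℝ)
    (x : EuclideanSpace ℝ (Fin n)) :
    Matrix.toEuclideanLin (svThreshold t Y) x =
      ∑ j, (if t ≤ singVal Y j then inner ℝ (rightSingVec Y j) x else 0) •
        Matrix.toEuclideanLin Y (rightSingVec Y j) := by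
  rw [svThreshold, map_sum, LinearMap.sum_apply, Finset.sum_filter]
  refine Finset.sum_congr rfl fun j _ => ?_
  split_ifs with h
  · rw [map_smul, LinearMap.smul_apply, toEuclideanLin_outerProd, smul_comm,
      singVal_smul_leftSingVec]
  · simp

/-- Only components with singular value below `t` are discarded, and they remain orthogonal after
applying `Y`. -/
theorem norm_sq_svThreshold_sub_le (t : ℝ) (Y : Matrix (Fin m) (Fin n) ℝ)
    (x : EuclideanSpace ℝ (Fin n)) :
    ‖Matrix.toEuclideanLin (svThreshold t Y) x - Matrix.toEuclideanLin Y x‖ ^ 2 ≤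
      t ^ 2 * ‖x‖ ^ 2 := by
  classical
  rw [toEuclideanLin_svThreshold, toEuclideanLin_eq_sum Y x, ← Finset.sum_sub_distrib]
  simp_rw [← sub_smul]
  rw [norm_sq_sum_smul_toEuclideanLin, ← (rightSingVec Y).sum_sq_inner_right x, Finset.mul_sum]
  refine Finset.sum_le_sum fun j _ => ?_
  split_ifs with h
  · rw [sub_self, zero_pow two_ne_zero, zero_mul]; positivity
  · have h1 : singVal Y j ^ 2 ≤ t ^ 2 := by
      gcongr
      · exact singVal_nonneg Y j
      · exact (not_le.1 h).le
    calc _ = inner ℝ (rightSingVec Y j) x ^ 2 * singVal Y j ^ 2 := by ring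
      _ ≤ inner ℝ (rightSingVec Y j) x ^ 2 * t ^ 2 := by gcongr
      _ = _ := mul_comm _ _

theorem toEuclideanLin_transpose_mul_self_pow (A : Matrix (Fin m) (Fin n) ℝ) (p : ℕ) (j : Fin n) :
    Matrix.toEuclideanLin ((A.transpose * A) ^ p) (rightSingVec A j) =
      (singVal A j ^ 2) ^ p • rightSingVec A j := by
  have h1 : Matrix.toEuclideanLin (A.transpose * A) (rightSingVec A j) =
      (singVal A j ^ 2) • rightSingVec A j := by
    have h := (Matrix.toEuclideanLin A).isSymmetric_adjoint_comp_self.apply_eigenvectorBasis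
      (finrank_euclideanSpace_fin (𝕜 := ℝ) (n := n)) j
    rw [singVal, LinearMap.sq_singularValues_fin _ (finrank_euclideanSpace_fin (𝕜 := ℝ) (n := n))]
    rw [← Matrix.conjTranspose_eq_transpose_of_trivial, Matrix.toLpLin_mul_same,
      Matrix.toEuclideanLin_conjTranspose_eq_adjoint]
    exact h
  rw [Matrix.toLpLin_pow]
  induction p with
  | zero => simp
  | succ p ih => rw [pow_succ, Module.End.mul_apply, h1, map_smul, ih, smul_smul, mul_comm,
    ← pow_succ]

theorem Matrix.trace_eq_sum_inner (B : Matrix (Fin n) (Fin n) ℝ)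
    (b : OrthonormalBasis (Fin n) ℝ (EuclideanSpace ℝ (Fin n))) :
    B.trace = ∑ j, inner ℝ (b j) (Matrix.toEuclideanLin B (b j)) := by
  rw [← LinearMap.trace_eq_sum_inner, LinearMap.trace_eq_sum_inner _ (EuclideanSpace.basisFun _ ℝ)]
  simp [Matrix.trace, EuclideanSpace.inner_single_left, Matrix.toLpLin_apply]

theorem trace_transpose_mul_self_pow (A : Matrix (Fin m) (Fin n) ℝ) (p : ℕ) :
    ((A.transpose * A) ^ p).trace = ∑ j, (singVal A j ^ 2) ^ p := by
  rw [Matrix.trace_eq_sum_inner _ (rightSingVec A)]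
  refine Finset.sum_congr rfl fun j _ => ?_
  rw [toEuclideanLin_transpose_mul_self_pow, inner_smul_right, OrthonormalBasis.inner_eq_ite]
  simp

theorem trace_transpose_mul_self_pow_nonneg (A : Matrix (Fin m) (Fin n) ℝ) (p : ℕ) :
    0 ≤ ((A.transpose * A) ^ p).trace := by
  rw [trace_transpose_mul_self_pow]
  positivity

/-- Schatten norm control of a matrix on an orthonormal family. -/
theorem sum_norm_sq_pow_le_trace (A : Matrix (Fin m) (Fin n) ℝ) (p : ℕ) {ι : Type*} [Fintype ι]
    {w : ι → EuclideanSpace ℝ (Fin n)} (hw : Orthonormal ℝ w) :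
    ∑ i, (‖Matrix.toEuclideanLin A (w i)‖ ^ 2) ^ p ≤ ((A.transpose * A) ^ p).trace := by
  rw [trace_transpose_mul_self_pow]
  calc ∑ i, (‖Matrix.toEuclideanLin A (w i)‖ ^ 2) ^ p
      ≤ ∑ i, ∑ j, inner ℝ (rightSingVec A j) (w i) ^ 2 * (singVal A j ^ 2) ^ p := by
        refine Finset.sum_le_sum fun i _ => ?_
        rw [norm_sq_toEuclideanLin]
        -- Jensen for `x ^ p`, with weights `⟪v_j, w_i⟫ ^ 2` that sum to 1 over `j` since `w_i` is a
        -- unit vector. Bessel's inequality then bounds their sum over `i`.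
        refine Real.pow_arith_mean_le_arith_mean_pow _ _ _ (fun _ _ => sq_nonneg _) ?_
          (fun _ _ => sq_nonneg _) p
        rw [(rightSingVec A).sum_sq_inner_right, hw.1 i, one_pow]
    _ = ∑ j, (∑ i, inner ℝ (rightSingVec A j) (w i) ^ 2) * (singVal A j ^ 2) ^ p := by
        rw [Finset.sum_comm]
        simp_rw [Finset.sum_mul]
    _ ≤ ∑ j, (singVal A j ^ 2) ^ p := by
        refine Finset.sum_le_sum fun j _ => ?_
        refine mul_le_of_le_one_left (by positivity) ?_
        have h := hw.sum_inner_products_le (rightSingVec A j) (s := Finset.univ)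
        rw [(rightSingVec A).orthonormal.1 j, one_pow] at h
        refine le_trans (Finset.sum_le_sum fun i _ => ?_) h
        rw [real_inner_comm, Real.norm_eq_abs, sq_abs]

/-- The sum of the squared entries of a matrix. -/
def frobSq (E : Matrix (Fin m) (Fin n) ℝ) : ℝ := ∑ i, ∑ j, E i j ^ 2

theorem frobSq_nonneg (E : Matrix (Fin m) (Fin n) ℝ) : 0 ≤ frobSq E :=
  Finset.sum_nonneg fun _ _ => Finset.sum_nonneg fun _ _ => sq_nonneg _

theorem toEuclideanLin_apply_eq_inner (E : Matrix (Fin m) (Fin n) ℝ)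
    (x : EuclideanSpace ℝ (Fin n)) (i : Fin m) :
    Matrix.toEuclideanLin E x i = inner ℝ (WithLp.toLp 2 (E i)) x := by
  simp [Matrix.toLpLin_apply, Matrix.mulVec, dotProduct, PiLp.inner_apply, mul_comm]

theorem norm_sq_toLp_row (E : Matrix (Fin m) (Fin n) ℝ) (i : Fin m) :
    ‖(WithLp.toLp 2 (E i) : EuclideanSpace ℝ (Fin n))‖ ^ 2 = ∑ j, E i j ^ 2 := by
  rw [EuclideanSpace.norm_sq_eq]
  simp

/-- Bessel's inequality, row by row. -/
theorem sum_norm_sq_le_frobSq (E : Matrix (Fin m) (Fin n) ℝ) {ι : Type*} [Fintype ι]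
    {w : ι → EuclideanSpace ℝ (Fin n)} (hw : Orthonormal ℝ w) :
    ∑ l, ‖Matrix.toEuclideanLin E (w l)‖ ^ 2 ≤ frobSq E := by
  simp_rw [EuclideanSpace.norm_sq_eq]
  rw [Finset.sum_comm, frobSq]
  refine Finset.sum_le_sum fun i _ => ?_
  rw [← norm_sq_toLp_row]
  refine le_trans (Finset.sum_le_sum fun l _ => ?_)
    (hw.sum_inner_products_le (WithLp.toLp 2 (E i)) (s := Finset.univ))
  rw [toEuclideanLin_apply_eq_inner, real_inner_comm]

/-- The rows of `D` are orthogonal to its kernel, so an orthonormal basis of the orthogonal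
complement computes their norms. The sum then has only as many terms as the rank of `D`. -/
theorem frobSq_eq_sum_norm_sq (D : Matrix (Fin m) (Fin n) ℝ) :
    frobSq D = ∑ l, ‖Matrix.toEuclideanLin D
      (stdOrthonormalBasis ℝ (LinearMap.ker (Matrix.toEuclideanLin D))ᗮ l :
        EuclideanSpace ℝ (Fin n))‖ ^ 2 := by
  simp_rw [EuclideanSpace.norm_sq_eq]
  rw [Finset.sum_comm, frobSq]
  refine Finset.sum_congr rfl fun i _ => ?_
  have hmem : (WithLp.toLp 2 (D i) : EuclideanSpace ℝ (Fin n)) ∈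
      (LinearMap.ker (Matrix.toEuclideanLin D))ᗮ := by
    rw [Submodule.mem_orthogonal']
    intro x hx
    rw [← toEuclideanLin_apply_eq_inner, LinearMap.mem_ker.1 hx]
    rfl
  rw [← norm_sq_toLp_row]
  have h := (stdOrthonormalBasis ℝ (LinearMap.ker (Matrix.toEuclideanLin D))ᗮ).sum_sq_inner_left
    ⟨_, hmem⟩
  rw [Submodule.coe_norm] at h
  rw [← h]
  refine Finset.sum_congr rfl fun l _ => ?_
  rw [toEuclideanLin_apply_eq_inner, Real.norm_eq_abs, sq_abs, Submodule.coe_inner]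

theorem Submodule.finrank_add_finrank_le_finrank_inf_add {W : Type*} [AddCommGroup W] [Module ℝ W]
    [FiniteDimensional ℝ W] (U V : Submodule ℝ W) :
    Module.finrank ℝ U + Module.finrank ℝ V ≤
      Module.finrank ℝ (U ⊓ V : Submodule ℝ W) + Module.finrank ℝ W := by
  have h1 := Submodule.finrank_sup_add_finrank_inf_eq U V
  have h2 := Submodule.finrank_le (U ⊔ V)
  omega

open Classical in
/-- The number of singular values that are at least `t`. -/
noncomputable def numLarge (t : ℝ) (Y : Matrix (Fin m) (Fin n) ℝ) : ℕ :=
  {j | t ≤ singVal Y j}.toFinset.card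

/-- The span of the right singular vectors that belong to singular values at least `t`. -/
noncomputable def largeSpan (t : ℝ) (Y : Matrix (Fin m) (Fin n) ℝ) :
    Submodule ℝ (EuclideanSpace ℝ (Fin n)) :=
  Submodule.span ℝ (Set.range fun j : {j // t ≤ singVal Y j} => rightSingVec Y j)

theorem finrank_largeSpan (t : ℝ) (Y : Matrix (Fin m) (Fin n) ℝ) :
    Module.finrank ℝ (largeSpan t Y) = numLarge t Y := by
  classical
  rw [largeSpan, finrank_span_eq_card, numLarge, Fintype.card_subtype]
  · congr 1
    ext j
    simp
  · exact ((rightSingVec Y).orthonormal.comp _ Subtype.val_injective).linearIndependent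

theorem inner_eq_zero_of_mem_largeSpan {t : ℝ} {Y : Matrix (Fin m) (Fin n) ℝ}
    {x : EuclideanSpace ℝ (Fin n)} (hx : x ∈ largeSpan t Y) {j : Fin n}
    (hj : ¬ t ≤ singVal Y j) : inner ℝ (rightSingVec Y j) x = 0 := by
  have h : largeSpan t Y ≤ (Submodule.span ℝ {rightSingVec Y j})ᗮ := by
    rw [largeSpan, Submodule.span_le]
    rintro _ ⟨⟨i, hi⟩, rfl⟩
    rw [SetLike.mem_coe, Submodule.mem_orthogonal_singleton_iff_inner_right,
      OrthonormalBasis.inner_eq_ite, if_neg]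
    rintro rfl
    exact hj hi
  exact Submodule.mem_orthogonal_singleton_iff_inner_right.1 (h hx)

theorem le_norm_sq_of_mem_largeSpan {t : ℝ} (ht : 0 ≤ t) {Y : Matrix (Fin m) (Fin n) ℝ}
    {x : EuclideanSpace ℝ (Fin n)} (hx : x ∈ largeSpan t Y) :
    t ^ 2 * ‖x‖ ^ 2 ≤ ‖Matrix.toEuclideanLin Y x‖ ^ 2 := by
  rw [norm_sq_toEuclideanLin, ← (rightSingVec Y).sum_sq_inner_right x, Finset.mul_sum]
  refine Finset.sum_le_sum fun j _ => ?_
  by_cases hj : t ≤ singVal Y j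
  · rw [mul_comm]
    gcongr
  · rw [inner_eq_zero_of_mem_largeSpan hx hj]
    simp

theorem svThreshold_apply_eq_zero {t : ℝ} {Y : Matrix (Fin m) (Fin n) ℝ}
    {x : EuclideanSpace ℝ (Fin n)} (hx : x ∈ (largeSpan t Y)ᗮ) :
    Matrix.toEuclideanLin (svThreshold t Y) x = 0 := by
  classical
  rw [toEuclideanLin_svThreshold]
  refine Finset.sum_eq_zero fun j _ => ?_
  split_ifs with hj
  · rw [(Submodule.mem_orthogonal _ _).1 hx _ (Submodule.subset_span ⟨⟨j, hj⟩, rfl⟩), zero_smul]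
  · rw [zero_smul]

/-- If `Y` is the sum of a matrix of small rank, a matrix of small Frobenius norm and a noise
matrix, then it has few large singular values. -/
theorem numLarge_le {L E A : Matrix (Fin m) (Fin n) ℝ} {K : ℕ}
    (hL : n ≤ Module.finrank ℝ (LinearMap.ker (Matrix.toEuclideanLin L)) + K)
    {s d : ℝ} (hs : 0 < s) (hd : 0 < d) (p : ℕ) :
    (numLarge (s + d) (L + E + A) : ℝ) ≤
      K + ((A.transpose * A) ^ p).trace / (s ^ 2) ^ p + frobSq E / d ^ 2 := by
  -- Intersecting with the kernel of `L` costs at most `K` dimensions. On what remains only `E + A`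
  -- acts, yet unit vectors still have image of norm at least `s + d`.
  set V := largeSpan (s + d) (L + E + A) ⊓ LinearMap.ker (Matrix.toEuclideanLin L) with hV
  have h1 : numLarge (s + d) (L + E + A) ≤ K + Module.finrank ℝ V := by
    have := Submodule.finrank_add_finrank_le_finrank_inf_add (largeSpan (s + d) (L + E + A))
      (LinearMap.ker (Matrix.toEuclideanLin L))
    rw [← hV, finrank_largeSpan, finrank_euclideanSpace_fin] at this
    omega
  have h2 : (numLarge (s + d) (L + E + A) : ℝ) ≤ K + Module.finrank ℝ V := by exact_mod_cast h1
  refine h2.trans ?_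
  rw [add_assoc]
  refine add_le_add_right ?_ _
  let w : Fin (Module.finrank ℝ V) → EuclideanSpace ℝ (Fin n) := fun l =>
    stdOrthonormalBasis ℝ V l
  have hw : Orthonormal ℝ w :=
    (stdOrthonormalBasis ℝ V).orthonormal.comp_linearIsometry V.subtypeₗᵢ
  have hA := sum_norm_sq_pow_le_trace A p hw
  have hE := sum_norm_sq_le_frobSq E hw
  calc (Module.finrank ℝ V : ℝ) = ∑ l : Fin (Module.finrank ℝ V), (1 : ℝ) := by simp
    _ ≤ ∑ l, ((‖Matrix.toEuclideanLin A (w l)‖ ^ 2) ^ p / (s ^ 2) ^ p +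
          ‖Matrix.toEuclideanLin E (w l)‖ ^ 2 / d ^ 2) := by
        refine Finset.sum_le_sum fun l _ => ?_
        have hwV : w l ∈ V := (stdOrthonormalBasis ℝ V l).2
        have h3 := le_norm_sq_of_mem_largeSpan (by positivity) hwV.1
        rw [hw.1 l, one_pow, mul_one] at h3
        have h4 : s + d ≤ ‖Matrix.toEuclideanLin (L + E + A) (w l)‖ :=
          (sq_le_sq₀ (by positivity) (norm_nonneg _)).1 h3
        have h5 : Matrix.toEuclideanLin (L + E + A) (w l) =
            Matrix.toEuclideanLin E (w l) + Matrix.toEuclideanLin A (w l) := by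
          rw [map_add, map_add, LinearMap.add_apply, LinearMap.add_apply,
            LinearMap.mem_ker.1 hwV.2, zero_add]
        rw [h5] at h4
        have h6 := h4.trans (norm_add_le _ _)
        -- Either `A` contributes at least `s` or `E` at least `d`, so each basis vector makes one
        -- of the two quotients at least 1.
        by_cases h7 : s ≤ ‖Matrix.toEuclideanLin A (w l)‖
        · have : 1 ≤ (‖Matrix.toEuclideanLin A (w l)‖ ^ 2) ^ p / (s ^ 2) ^ p := by
            rw [one_le_div (by positivity)]
            gcongr
          have : 0 ≤ ‖Matrix.toEuclideanLin E (w l)‖ ^ 2 / d ^ 2 := by positivity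
          linarith
        · have : 1 ≤ ‖Matrix.toEuclideanLin E (w l)‖ ^ 2 / d ^ 2 := by
            rw [one_le_div (by positivity)]
            gcongr
            linarith
          have : 0 ≤ (‖Matrix.toEuclideanLin A (w l)‖ ^ 2) ^ p / (s ^ 2) ^ p := by positivity
          linarith
    _ ≤ _ := by
        rw [Finset.sum_add_distrib, ← Finset.sum_div, ← Finset.sum_div]
        gcongr

/-- Above `s` the ratio `x / s` is at most its own `p`-th power. This lets the trace of a `p`-th
power control squared norms of the noise. -/
theorem sq_le_add_pow_div {x s : ℝ} (hx : 0 ≤ x) (hs : 0 < s) {p : ℕ} (hp : 0 < p) :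
    x ≤ s + s * (x ^ p / s ^ p) := by
  rcases le_total x s with h | h
  · have : 0 ≤ s * (x ^ p / s ^ p) := by positivity
    linarith
  · have h1 : 1 ≤ x / s := (one_le_div hs).2 h
    have h2 : x / s ≤ (x / s) ^ p := le_self_pow₀ h1 hp.ne'
    rw [← div_pow]
    calc x = s * (x / s) := by field_simp
      _ ≤ s * (x / s) ^ p := by gcongr
      _ ≤ _ := by linarith

/-- The Frobenius error of singular value thresholding. -/
theorem frobSq_svThreshold_sub_le {L E A : Matrix (Fin m) (Fin n) ℝ} {K : ℕ}
    (hL : n ≤ Module.finrank ℝ (LinearMap.ker (Matrix.toEuclideanLin L)) + K)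
    {s : ℝ} (hs : 0 < s) (t : ℝ) {p : ℕ} (hp : 0 < p) :
    frobSq (svThreshold t (L + E + A) - L) ≤
      3 * ((numLarge t (L + E + A) + K) * (t ^ 2 + s ^ 2) + frobSq E +
        s ^ 2 * (((A.transpose * A) ^ p).trace / (s ^ 2) ^ p)) := by
  set D := svThreshold t (L + E + A) - L with hD
  set W := (LinearMap.ker (Matrix.toEuclideanLin D))ᗮ with hW
  -- `D` vanishes on the part of the kernel of `L` orthogonal to the retained singular vectors, so
  -- its rank is at most the number of these plus `K`.
  have hrank : Module.finrank ℝ W ≤ numLarge t (L + E + A) + K := by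
    have h1 := Submodule.finrank_add_finrank_orthogonal
      (LinearMap.ker (Matrix.toEuclideanLin D))
    rw [← hW] at h1
    have h2 := Submodule.finrank_add_finrank_orthogonal (largeSpan t (L + E + A))
    have h3 := Submodule.finrank_add_finrank_le_finrank_inf_add (largeSpan t (L + E + A))ᗮ
      (LinearMap.ker (Matrix.toEuclideanLin L))
    have h4 : (largeSpan t (L + E + A))ᗮ ⊓ LinearMap.ker (Matrix.toEuclideanLin L) ≤
        LinearMap.ker (Matrix.toEuclideanLin D) := by
      rintro x ⟨hx1, hx2⟩
      rw [LinearMap.mem_ker, hD, map_sub, LinearMap.sub_apply, svThreshold_apply_eq_zero hx1,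
        LinearMap.mem_ker.1 hx2, sub_zero]
    have h5 := Submodule.finrank_mono h4
    rw [finrank_largeSpan, finrank_euclideanSpace_fin] at h2
    rw [finrank_euclideanSpace_fin] at h1 h3
    omega
  let w : Fin (Module.finrank ℝ W) → EuclideanSpace ℝ (Fin n) := fun l =>
    stdOrthonormalBasis ℝ W l
  have hw : Orthonormal ℝ w :=
    (stdOrthonormalBasis ℝ W).orthonormal.comp_linearIsometry W.subtypeₗᵢ
  have hA := sum_norm_sq_pow_le_trace A p hw
  have hE := sum_norm_sq_le_frobSq E hw
  have hterm : ∀ l, ‖Matrix.toEuclideanLin D (w l)‖ ^ 2 ≤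
      3 * ((t ^ 2 + s ^ 2) + ‖Matrix.toEuclideanLin E (w l)‖ ^ 2 +
        s ^ 2 * ((‖Matrix.toEuclideanLin A (w l)‖ ^ 2) ^ p / (s ^ 2) ^ p)) := by
    intro l
    have h1 := norm_sq_svThreshold_sub_le t (L + E + A) (w l)
    rw [hw.1 l, one_pow, mul_one] at h1
    have h2 := sq_le_add_pow_div (sq_nonneg ‖Matrix.toEuclideanLin A (w l)‖) (pow_pos hs 2) hp
    -- The three terms are the discarded part of the data, of norm at most `t`, the approximation
    -- error and the noise. The factor 3 comes from `(a + b + c) ^ 2 ≤ 3 (a ^ 2 + b ^ 2 + c ^ 2)`.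
    have h3 : Matrix.toEuclideanLin D (w l) =
        (Matrix.toEuclideanLin (svThreshold t (L + E + A)) (w l) -
          Matrix.toEuclideanLin (L + E + A) (w l)) + Matrix.toEuclideanLin E (w l) +
          Matrix.toEuclideanLin A (w l) := by
      rw [hD]
      simp only [map_sub, map_add, LinearMap.sub_apply, LinearMap.add_apply]
      abel
    have h4 := norm_add₃_le (a := Matrix.toEuclideanLin (svThreshold t (L + E + A)) (w l) -
          Matrix.toEuclideanLin (L + E + A) (w l)) (b := Matrix.toEuclideanLin E (w l))
          (c := Matrix.toEuclideanLin A (w l))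
    rw [← h3] at h4
    set a := ‖Matrix.toEuclideanLin (svThreshold t (L + E + A)) (w l) -
          Matrix.toEuclideanLin (L + E + A) (w l)‖
    set b := ‖Matrix.toEuclideanLin E (w l)‖
    set c := ‖Matrix.toEuclideanLin A (w l)‖
    have h5 : ‖Matrix.toEuclideanLin D (w l)‖ ^ 2 ≤ (a + b + c) ^ 2 := by gcongr
    nlinarith [sq_nonneg (a - b), sq_nonneg (b - c), sq_nonneg (a - c)]
  rw [frobSq_eq_sum_norm_sq]
  calc ∑ l, ‖Matrix.toEuclideanLin D (w l)‖ ^ 2 ≤ _ := Finset.sum_le_sum fun l _ => hterm l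
    _ = 3 * (Module.finrank ℝ W * (t ^ 2 + s ^ 2) +
        ∑ l, ‖Matrix.toEuclideanLin E (w l)‖ ^ 2 +
        s ^ 2 * ((∑ l, (‖Matrix.toEuclideanLin A (w l)‖ ^ 2) ^ p) / (s ^ 2) ^ p)) := by
      rw [← Finset.mul_sum, Finset.sum_add_distrib, Finset.sum_add_distrib, ← Finset.mul_sum,
        ← Finset.sum_div]
      simp [mul_add]
    _ ≤ _ := by
      have : (Module.finrank ℝ W : ℝ) ≤ numLarge t (L + E + A) + K := by exact_mod_cast hrank
      gcongr

end SVThreshold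

/-! ### Measurability of singular value thresholding -/

section Measurability

variable {m n : ℕ}

/-- A matrix with continuous dependence on `Y` that tends to `svThreshold t Y` as `l → ∞`. -/
noncomputable def svSmooth (t : ℝ) (l : ℕ) (Y : Matrix (Fin m) (Fin n) ℝ) :
    Matrix (Fin m) (Fin n) ℝ :=
  Y * (((Y.transpose * Y) ^ l + ((t ^ 2) ^ l / (l + 1)) • 1)⁻¹ * (Y.transpose * Y) ^ l)

theorem posDef_regularized {t : ℝ} (ht : 0 < t) (l : ℕ) (Y : Matrix (Fin m) (Fin n) ℝ) :
    ((Y.transpose * Y) ^ l + ((t ^ 2) ^ l / (l + 1)) • (1 : Matrix (Fin n) (Fin n) ℝ)).PosDef := by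
  refine Matrix.PosDef.posSemidef_add ?_ (Matrix.PosDef.one.smul (by positivity))
  refine Matrix.PosSemidef.pow ?_ l
  rw [← Matrix.conjTranspose_eq_transpose_of_trivial]
  exact Matrix.posSemidef_conjTranspose_mul_self Y

theorem continuous_svSmooth {t : ℝ} (ht : 0 < t) (l : ℕ) :
    Continuous (svSmooth t l : Matrix (Fin m) (Fin n) ℝ → Matrix (Fin m) (Fin n) ℝ) := by
  have h1 : Continuous fun Y : Matrix (Fin m) (Fin n) ℝ =>
      (Y.transpose * Y) ^ l + ((t ^ 2) ^ l / (l + 1)) • (1 : Matrix (Fin n) (Fin n) ℝ) := by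
    fun_prop
  have h2 : Continuous fun Y : Matrix (Fin m) (Fin n) ℝ =>
      ((Y.transpose * Y) ^ l + ((t ^ 2) ^ l / (l + 1)) • (1 : Matrix (Fin n) (Fin n) ℝ))⁻¹ := by
    simp only [Matrix.inv_def, Ring.inverse_eq_inv']
    exact (h1.matrix_det.inv₀ fun Y => (posDef_regularized ht l Y).det_pos.ne').smul
      h1.matrix_adjugate
  unfold svSmooth
  fun_prop

theorem toEuclideanLin_svSmooth {t : ℝ} (ht : 0 < t) (l : ℕ) (Y : Matrix (Fin m) (Fin n) ℝ)
    (j : Fin n) : Matrix.toEuclideanLin (svSmooth t l Y) (rightSingVec Y j) =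
      ((singVal Y j ^ 2) ^ l / ((singVal Y j ^ 2) ^ l + (t ^ 2) ^ l / (l + 1))) •
        Matrix.toEuclideanLin Y (rightSingVec Y j) := by
  set x := singVal Y j ^ 2 with hx
  set c := (t ^ 2) ^ l / ((l : ℝ) + 1) with hc
  set R := (Y.transpose * Y) ^ l + c • (1 : Matrix (Fin n) (Fin n) ℝ) with hR
  have hpos : 0 < x ^ l + c := by positivity
  have h1 : Matrix.toEuclideanLin R (rightSingVec Y j) = (x ^ l + c) • rightSingVec Y j := by
    rw [hR, map_add, LinearMap.add_apply, toEuclideanLin_transpose_mul_self_pow, map_smul,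
      Matrix.toLpLin_one, add_smul]
    rfl
  have h2 : Matrix.toEuclideanLin R⁻¹ (rightSingVec Y j) = (x ^ l + c)⁻¹ • rightSingVec Y j := by
    have h3 : rightSingVec Y j = (x ^ l + c)⁻¹ • Matrix.toEuclideanLin R (rightSingVec Y j) := by
      rw [h1, smul_smul, inv_mul_cancel₀ hpos.ne', one_smul]
    conv_lhs => rw [h3]
    rw [map_smul, ← LinearMap.comp_apply, ← Matrix.toLpLin_mul_same,
      Matrix.nonsing_inv_mul _ (posDef_regularized ht l Y).det_pos.ne'.isUnit, Matrix.toLpLin_one]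
    rfl
  rw [svSmooth, Matrix.toLpLin_mul_same, Matrix.toLpLin_mul_same, LinearMap.comp_apply,
    LinearMap.comp_apply, toEuclideanLin_transpose_mul_self_pow, map_smul, h2, map_smul, map_smul,
    smul_smul, div_eq_mul_inv]

-- For `x < a` the ratio `(x / a) ^ l` decays geometrically and beats the factor `l + 1`. At `x = a`
-- it is the weight `1 / (l + 1)` that forces the limit 1, matching the non-strict threshold.
open Classical in
theorem tendsto_smooth_step {x a : ℝ} (hx : 0 ≤ x) (ha : 0 < a) :
    Tendsto (fun l : ℕ => x ^ l / (x ^ l + a ^ l / (l + 1))) atTop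
      (𝓝 (if a ≤ x then 1 else 0)) := by
  split_ifs with h
  · have hx' : 0 < x := ha.trans_le h
    have h1 : Tendsto (fun l : ℕ => 1 - 1 / ((l : ℝ) + 1)) atTop (𝓝 1) := by
      simpa using tendsto_const_nhds.sub (tendsto_one_div_add_atTop_nhds_zero_nat (𝕜 := ℝ))
    refine tendsto_of_tendsto_of_tendsto_of_le_of_le h1 tendsto_const_nhds ?_ ?_
    · intro l
      have h2 : a ^ l ≤ x ^ l := by gcongr
      have h3 : 0 < x ^ l := by positivity
      have h4 : (0 : ℝ) < l + 1 := by positivity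
      have h5 : a ^ l / (l + 1) ≤ x ^ l / (l + 1) := by gcongr
      dsimp only
      rw [le_div_iff₀ (by positivity)]
      have h6 : 0 ≤ 1 - 1 / ((l : ℝ) + 1) := by
        rw [sub_nonneg, div_le_one h4]
        have : (0 : ℝ) ≤ l := by positivity
        linarith
      calc (1 - 1 / ((l : ℝ) + 1)) * (x ^ l + a ^ l / (l + 1))
          ≤ (1 - 1 / ((l : ℝ) + 1)) * (x ^ l + x ^ l / (l + 1)) := by gcongr
        _ = x ^ l * (1 - (1 / ((l : ℝ) + 1)) ^ 2) := by ring
        _ ≤ x ^ l * 1 := by gcongr; linarith [sq_nonneg (1 / ((l : ℝ) + 1))]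
        _ = x ^ l := mul_one _
    · intro l
      exact div_le_one_of_le₀ (le_add_of_nonneg_right (by positivity)) (by positivity)
  · have hxa : x / a < 1 := (div_lt_one ha).2 (not_le.1 h)
    have h0 : 0 ≤ x / a := by positivity
    have h1 : Tendsto (fun l : ℕ => (l : ℝ) * (x / a) ^ l + (x / a) ^ l) atTop (𝓝 0) := by
      simpa using (tendsto_self_mul_const_pow_of_lt_one h0 hxa).add
        (tendsto_pow_atTop_nhds_zero_of_lt_one h0 hxa)
    refine tendsto_of_tendsto_of_tendsto_of_le_of_le tendsto_const_nhds h1 ?_ ?_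
    · intro l
      dsimp only
      positivity
    · intro l
      dsimp only
      calc x ^ l / (x ^ l + a ^ l / (l + 1)) ≤ x ^ l / (a ^ l / (l + 1)) := by
            gcongr
            exact le_add_of_nonneg_left (by positivity)
        _ = l * (x / a) ^ l + (x / a) ^ l := by
            rw [div_pow]; field_simp

theorem tendsto_svSmooth {t : ℝ} (ht : 0 < t) (Y : Matrix (Fin m) (Fin n) ℝ) (i : Fin m)
    (j : Fin n) : Tendsto (fun l => svSmooth t l Y i j) atTop (𝓝 (svThreshold t Y i j)) := by
  classical
  have hentry : ∀ B : Matrix (Fin m) (Fin n) ℝ,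
      B i j = Matrix.toEuclideanLin B (EuclideanSpace.single j 1) i := by
    intro B
    simp [Matrix.toLpLin_apply]
  have hvec : Tendsto (fun l => Matrix.toEuclideanLin (svSmooth t l Y) (EuclideanSpace.single j 1))
      atTop (𝓝 (Matrix.toEuclideanLin (svThreshold t Y) (EuclideanSpace.single j 1))) := by
    have h1 : ∀ l, Matrix.toEuclideanLin (svSmooth t l Y) (EuclideanSpace.single j 1) =
        ∑ q, inner ℝ (rightSingVec Y q) (EuclideanSpace.single j 1) •
          (((singVal Y q ^ 2) ^ l / ((singVal Y q ^ 2) ^ l + (t ^ 2) ^ l / (l + 1))) •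
            Matrix.toEuclideanLin Y (rightSingVec Y q)) := by
      intro l
      conv_lhs => rw [← (rightSingVec Y).sum_repr' (EuclideanSpace.single j 1)]
      simp only [map_sum, map_smul, toEuclideanLin_svSmooth ht]
    simp_rw [h1, toEuclideanLin_svThreshold]
    refine tendsto_finsetSum _ fun q _ => ?_
    have h2 := tendsto_smooth_step (sq_nonneg (singVal Y q)) (pow_pos ht 2)
    have h3 := (h2.smul_const (Matrix.toEuclideanLin Y (rightSingVec Y q))).const_smul
      (inner ℝ (rightSingVec Y q) (EuclideanSpace.single j (1 : ℝ)))
    convert h3 using 2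
    simp only [sq_le_sq₀ ht.le (singVal_nonneg Y q)]
    split_ifs <;> simp
  simp_rw [hentry]
  exact ((EuclideanSpace.proj i : EuclideanSpace ℝ (Fin m) →L[ℝ] ℝ).continuous.tendsto _).comp hvec

variable {Ω : Type*} [MeasurableSpace Ω]

/-- The singular vectors are chosen without any regularity in `Y`; measurability comes from a
pointwise limit of continuous maps. -/
theorem measurable_svThreshold {t : ℝ} (ht : 0 < t) {Y : Ω → Matrix (Fin m) (Fin n) ℝ}
    (hY : ∀ i j, Measurable fun ω => Y ω i j) (i : Fin m) (j : Fin n) :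
    Measurable fun ω => svThreshold t (Y ω) i j := by
  refine measurable_of_tendsto_metrizable (f := fun l ω => svSmooth t l (Y ω) i j) (fun l => ?_)
    (tendsto_pi_nhds.2 fun ω => tendsto_svSmooth ht (Y ω) i j)
  have h1 : Continuous fun y : Fin m → Fin n → ℝ => svSmooth t l (Matrix.of y) i j :=
    ((continuous_svSmooth ht l).comp (f := fun y : Fin m → Fin n → ℝ => Matrix.of y)
      continuous_id).matrix_elem i j
  have h2 : Measurable fun ω => (fun i j => Y ω i j : Fin m → Fin n → ℝ) :=
    measurable_pi_iff.2 fun i => measurable_pi_iff.2 fun j => hY i j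
  exact h1.measurable.comp h2

theorem measurable_trunc : Measurable trunc := by
  unfold trunc
  fun_prop

theorem measurable_usvt {η : ℝ} (hη : 0 < η) (hm : 0 < m) {Y : Ω → Matrix (Fin m) (Fin n) ℝ}
    (hY : ∀ i j, Measurable fun ω => Y ω i j) (i : Fin m) (j : Fin n) :
    Measurable fun ω => usvt η (Y ω) i j := by
  refine measurable_trunc.comp (measurable_svThreshold ?_ hY i j)
  have : 0 < √(m : ℝ) := Real.sqrt_pos.2 (by exact_mod_cast hm)
  have := this.trans_le (le_max_left _ √(n : ℝ))
  positivity

theorem measurable_modifiedUSVT {η : ℝ} (hη : 0 < η) (hm : 0 < m)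
    {Y Q : Ω → Matrix (Fin m) (Fin n) ℝ} (hY : ∀ i j, Measurable fun ω => Y ω i j)
    (hQ : ∀ i j, Measurable fun ω => Q ω i j) (i : Fin m) (j : Fin n) :
    Measurable fun ω => modifiedUSVT η (Y ω) (Q ω) i j :=
  measurable_trunc.comp ((measurable_usvt hη hm hY i j).div (measurable_usvt hη hm hQ i j))

end Measurability

/-! ### Entrywise polynomials of a matrix of small rank -/

section LowRank

variable {m n : ℕ}

theorem Matrix.exists_rank_factorization (M : Matrix (Fin m) (Fin n) ℝ) :
    ∃ (U : Matrix (Fin m) (Fin M.rank) ℝ) (V : Matrix (Fin M.rank) (Fin n) ℝ), M = U * V := by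
  let b := Module.finBasis ℝ (LinearMap.range M.mulVecLin)
  refine ⟨Matrix.of fun i a => (b a : Fin m → ℝ) i,
    Matrix.of fun a j => b.repr ⟨M.mulVecLin (Pi.single j 1), LinearMap.mem_range_self _ _⟩ a, ?_⟩
  ext i j
  have h := congrArg (fun x => (Subtype.val x : Fin m → ℝ) i)
    (b.sum_repr ⟨M.mulVecLin (Pi.single j 1), LinearMap.mem_range_self _ _⟩)
  simp only [AddSubmonoidClass.coe_finsetSum, Submodule.coe_smul, Finset.sum_apply, Pi.smul_apply,
    smul_eq_mul, Matrix.mulVecLin_apply, Matrix.mulVec_single_one, Matrix.col_apply] at h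
  rw [← h, Matrix.mul_apply]
  refine Finset.sum_congr rfl fun a _ => ?_
  rw [mul_comm]
  simp only [Matrix.mulVecLin_apply, Matrix.mulVec_single_one]
  rfl

/-- With `M = U V`, expanding `(∑ a, U i a * V a j) ^ d` gives a sum over words of length `d` of a
function of `i` times a function of `j`. So the new matrix factors through the words of length at
most the degree. -/
theorem Matrix.rank_map_polynomial_le (M : Matrix (Fin m) (Fin n) ℝ) (q : Polynomial ℝ) :
    (M.map q.eval).rank ≤ ∑ d ∈ Finset.range (q.natDegree + 1), M.rank ^ d := by
  obtain ⟨U, V, hUV⟩ := M.exists_rank_factorization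
  let U' : Matrix (Fin m) ((d : Fin (q.natDegree + 1)) × (Fin d → Fin M.rank)) ℝ :=
    Matrix.of fun i x => q.coeff x.1 * ∏ s, U i (x.2 s)
  let V' : Matrix ((d : Fin (q.natDegree + 1)) × (Fin d → Fin M.rank)) (Fin n) ℝ :=
    Matrix.of fun x j => ∏ s, V (x.2 s) j
  have h : M.map q.eval = U' * V' := by
    ext i j
    rw [Matrix.map_apply, Polynomial.eval_eq_sum_range, Matrix.mul_apply, Fintype.sum_sigma,
      ← Fin.sum_univ_eq_sum_range (fun d => q.coeff d * M i j ^ d)]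
    refine Finset.sum_congr rfl fun d _ => ?_
    conv_lhs => rw [hUV, Matrix.mul_apply]
    rw [← Fin.prod_const, Finset.prod_univ_sum, Fintype.piFinset_univ, Finset.mul_sum]
    refine Finset.sum_congr rfl fun x _ => ?_
    simp only [U', V', Matrix.of_apply, Finset.prod_mul_distrib]
    ring
  rw [h]
  refine (Matrix.rank_mul_le_left _ _).trans ((Matrix.rank_le_card_width _).trans_eq ?_)
  rw [Fintype.card_sigma, ← Fin.sum_univ_eq_sum_range (fun d => M.rank ^ d)]
  simp

theorem Matrix.finrank_ker_toEuclideanLin (L : Matrix (Fin m) (Fin n) ℝ) :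
    Module.finrank ℝ (LinearMap.ker (Matrix.toEuclideanLin L)) + L.rank = n := by
  have h := LinearMap.finrank_range_add_finrank_ker (Matrix.toEuclideanLin L)
  rw [finrank_euclideanSpace_fin] at h
  rw [Matrix.rank_eq_finrank_range_toLin L (PiLp.basisFun 2 ℝ (Fin m)) (PiLp.basisFun 2 ℝ (Fin n)),
    ← Matrix.toLpLin_eq_toLin]
  exact (add_comm _ _).trans h

end LowRank

/-! ### The error of USVT for a random matrix -/

section USVTError

variable {m n : ℕ}

theorem trunc_sub_sq_le (a : ℝ) {b : ℝ} (hb : b ∈ Icc (-1 : ℝ) 1) :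
    (trunc a - b) ^ 2 ≤ (a - b) ^ 2 := by
  rw [sq_le_sq]
  obtain ⟨h1, h2⟩ := hb
  unfold trunc
  rcases le_total 1 a with h | h
  · rw [min_eq_left h, max_eq_right (by norm_num), abs_of_nonneg (by linarith),
      abs_of_nonneg (by linarith)]
    linarith
  · rw [min_eq_right h]
    rcases le_total (-1) a with h' | h'
    · rw [max_eq_right h']
    · rw [max_eq_left h', abs_of_nonpos (by linarith), abs_of_nonpos (by linarith)]
      linarith

theorem trunc_mem_Icc (a : ℝ) : trunc a ∈ Icc (-1 : ℝ) 1 :=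
  ⟨le_max_left _ _, max_le (by norm_num) (min_le_left _ _)⟩

theorem frobSq_usvt_sub_le_svThreshold (η : ℝ) (Y : Matrix (Fin m) (Fin n) ℝ)
    {Q : Matrix (Fin m) (Fin n) ℝ} (hQ : ∀ i j, Q i j ∈ Icc (-1 : ℝ) 1) :
    frobSq (usvt η Y - Q) ≤ frobSq (svThreshold ((2 + η) * max √(m : ℝ) √(n : ℝ)) Y - Q) := by
  refine Finset.sum_le_sum fun i _ => Finset.sum_le_sum fun j _ => ?_
  exact trunc_sub_sq_le _ (hQ i j)

theorem frobSq_sub_add_le (B L E : Matrix (Fin m) (Fin n) ℝ) :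
    frobSq (B - (L + E)) ≤ 2 * frobSq (B - L) + 2 * frobSq E := by
  simp only [frobSq, Finset.mul_sum, ← Finset.sum_add_distrib, Matrix.sub_apply, Matrix.add_apply]
  refine Finset.sum_le_sum fun i _ => Finset.sum_le_sum fun j _ => ?_
  nlinarith [sq_nonneg (B i j - L i j + E i j)]

/-- The error of USVT in terms of the trace of a power of the noise. -/
theorem frobSq_usvt_sub_le {η : ℝ} (hη : η ∈ Ioo (0 : ℝ) 1) (hm : 0 < m)
    {L E A : Matrix (Fin m) (Fin n) ℝ} (hQ : ∀ i j, (L + E) i j ∈ Icc (-1 : ℝ) 1) {K : ℕ}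
    (hL : L.rank ≤ K) {p : ℕ} (hp : 0 < p) :
    frobSq (usvt η (L + E + A) - (L + E)) ≤
      216 * ((max m n : ℕ) * K) + 162 * ((max m n : ℕ) *
        (((A.transpose * A) ^ p).trace / ((2 + η / 2) ^ 2 * (max m n : ℕ)) ^ p)) +
      440 * (frobSq E / η ^ 2) := by
  obtain ⟨h0, h1⟩ := hη
  set N : ℝ := ((max m n : ℕ) : ℝ) with hN
  have hNpos : 0 < N := by
    rw [hN]
    exact_mod_cast hm.trans_le (le_max_left m n)
  have hmax : max √(m : ℝ) √(n : ℝ) = √N := by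
    rw [hN, Nat.cast_max]
    exact Real.sqrt_monotone.map_max.symm
  have hsqrt : 0 < √N := Real.sqrt_pos.2 hNpos
  have hker : n ≤ Module.finrank ℝ (LinearMap.ker (Matrix.toEuclideanLin L)) + K := by
    have := L.finrank_ker_toEuclideanLin
    omega
  -- The threshold `(2 + η) √N` splits as `s + d`: `s` lies strictly above the noise level `2 √N`,
  -- and `d` is the margin left for `E`.
  set s := (2 + η / 2) * √N with hs
  set d := η / 2 * √N with hd
  have hs2 : s ^ 2 = (2 + η / 2) ^ 2 * N := by rw [hs, mul_pow, Real.sq_sqrt hNpos.le]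
  have hd2 : d ^ 2 = (η / 2) ^ 2 * N := by rw [hd, mul_pow, Real.sq_sqrt hNpos.le]
  have hspos : 0 < s := by positivity
  have hdpos : 0 < d := by positivity
  have hnum := numLarge_le hker hspos hdpos (E := E) (A := A) p
  have herr := frobSq_svThreshold_sub_le hker hspos (s + d) (E := E) (A := A) hp
  have ht : (2 + η) * max √(m : ℝ) √(n : ℝ) = s + d := by rw [hmax, hs, hd]; ring
  have husvt := frobSq_usvt_sub_le_svThreshold η (L + E + A) hQ
  rw [ht] at husvt
  have hsplit := frobSq_sub_add_le (svThreshold (s + d) (L + E + A)) L E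
  rw [← hs2]
  set T := ((A.transpose * A) ^ p).trace / (s ^ 2) ^ p with hT
  have hT0 : 0 ≤ T := div_nonneg (trace_transpose_mul_self_pow_nonneg _ _) (by positivity)
  have hF0 := frobSq_nonneg E
  set F := frobSq E
  have ht9 : (s + d) ^ 2 ≤ 9 * N := by
    have : s + d = (2 + η) * √N := by rw [hs, hd]; ring
    rw [this, mul_pow, Real.sq_sqrt hNpos.le]
    gcongr
    nlinarith
  have hs9 : s ^ 2 ≤ 9 * N := by
    rw [hs2]
    gcongr
    nlinarith
  have hFd : F / d ^ 2 * N = 4 * (F / η ^ 2) := by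
    rw [hd2]
    field_simp
    norm_num
  have hFη : F ≤ F / η ^ 2 := by
    rw [le_div_iff₀ (by positivity)]
    have : η ^ 2 ≤ 1 := by nlinarith
    nlinarith
  have hk : ((numLarge (s + d) (L + E + A) : ℝ) + K) * ((s + d) ^ 2 + s ^ 2) ≤
      (K + T + F / d ^ 2 + K) * (9 * N + 9 * N) := by gcongr
  have hsT : s ^ 2 * T ≤ 9 * N * T := by gcongr
  have hk' : (K + T + F / d ^ 2 + K) * (9 * N + 9 * N) =
      36 * (N * K) + 18 * (N * T) + 72 * (F / η ^ 2) := by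
    linear_combination 18 * hFd
  -- The constants are `2 * 3 * 36 = 216`, `2 * 3 * (18 + 9) = 162` and `2 * 3 * (72 + 1) + 2 =
  -- 440`.
  linarith

end USVTError

/-! ### Expected error of USVT for a signal close to low rank -/

section Consistency

variable {m n : ℕ} {Ω : Type*} [MeasurableSpace Ω] {P : Measure Ω}

theorem frobSq_le_of_abs_le {E : Matrix (Fin m) (Fin n) ℝ} {e : ℝ} (he : ∀ i j, |E i j| ≤ e) :
    frobSq E ≤ m * n * e ^ 2 := by
  calc frobSq E ≤ ∑ _i : Fin m, ∑ _j : Fin n, e ^ 2 := by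
        refine Finset.sum_le_sum fun i _ => Finset.sum_le_sum fun j _ => ?_
        rw [← sq_abs]
        gcongr
        exact he i j
    _ = _ := by simp; ring

theorem integrable_frobSq_usvt_sub [IsProbabilityMeasure P] {η : ℝ} (hη : 0 < η) (hm : 0 < m)
    {Y : Ω → Matrix (Fin m) (Fin n) ℝ} (hY : ∀ i j, Measurable fun ω => Y ω i j)
    {Q : Matrix (Fin m) (Fin n) ℝ} (hQ : ∀ i j, Q i j ∈ Icc (-1 : ℝ) 1) :
    Integrable (fun ω => frobSq (usvt η (Y ω) - Q)) P := by
  have hmeas : Measurable fun ω => frobSq (usvt η (Y ω) - Q) := by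
    refine Finset.measurable_fun_sum _ fun i _ => Finset.measurable_fun_sum _ fun j _ => ?_
    exact ((measurable_usvt hη hm hY i j).sub_const _).pow_const 2
  refine Integrable.of_bound hmeas.aestronglyMeasurable (m * n * 2 ^ 2) (ae_of_all _ fun ω => ?_)
  rw [Real.norm_of_nonneg (frobSq_nonneg _)]
  refine frobSq_le_of_abs_le fun i j => ?_
  have h1 : usvt η (Y ω) i j ∈ Icc (-1 : ℝ) 1 := trunc_mem_Icc _
  rw [Matrix.sub_apply, abs_le]
  exact ⟨by linarith [h1.1, (hQ i j).2], by linarith [h1.2, (hQ i j).1]⟩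

/-- The mean squared error of USVT for a matrix that is close to a matrix of small rank. -/
theorem IsCentredNoise.integral_frobSq_usvt_le [IsProbabilityMeasure P]
    {Z : Fin m × Fin n → Ω → ℝ} (hZ : IsCentredNoise P Z)
    {η : ℝ} (hη : η ∈ Ioo (0 : ℝ) 1) (hm : 0 < m) (hn : 0 < n)
    {Q L : Matrix (Fin m) (Fin n) ℝ} (hQ : ∀ i j, Q i j ∈ Icc (-1 : ℝ) 1) {e : ℝ}
    (he : ∀ i j, |Q i j - L i j| ≤ e) {K : ℕ} (hL : L.rank ≤ K) {p : ℕ} (hp : 0 < p) :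
    (∫ ω, frobSq (usvt η (Q + noiseMatrix Z ω) - Q) ∂P) / (m * n) ≤
      216 * K * (1 / m + 1 / n) + 162 * ((4 / (2 + η / 2) ^ 2) ^ p *
        (1 + (2 * p + 1 : ℝ) ^ (2 * p + 1) / n)) + 440 * (e ^ 2 / η ^ 2) := by
  have hmn : 0 < max m n := hm.trans_le (le_max_left m n)
  have hm' : (0 : ℝ) < m := by exact_mod_cast hm
  have hn' : (0 : ℝ) < n := by exact_mod_cast hn
  obtain ⟨hint, hmom⟩ := hZ.integral_trace_pow_le hp hmn
  have hN : (0 : ℝ) < (max m n : ℕ) := by exact_mod_cast hmn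
  have hNn : (n : ℝ) ≤ (max m n : ℕ) := by exact_mod_cast le_max_right m n
  have hNmn : ((max m n : ℕ) : ℝ) ≤ m + n := by
    exact_mod_cast max_le (Nat.le_add_right m n) (Nat.le_add_left n m)
  set N : ℝ := ((max m n : ℕ) : ℝ)
  have hη0 := hη.1
  set a : ℝ := (2 + η / 2) ^ 2 with ha
  have hapos : 0 < a := by positivity
  have hE : frobSq (Q - L) ≤ m * n * e ^ 2 := frobSq_le_of_abs_le he
  have hpt : ∀ ω, frobSq (usvt η (Q + noiseMatrix Z ω) - Q) ≤
      216 * (N * K) + 162 * (N * ((((noiseMatrix Z ω).transpose * noiseMatrix Z ω) ^ p).trace /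
        (a * N) ^ p)) + 440 * (m * n * e ^ 2 / η ^ 2) := by
    intro ω
    have hQ' : Q = L + (Q - L) := by abel
    have h := frobSq_usvt_sub_le hη hm (L := L) (E := Q - L) (A := noiseMatrix Z ω)
      (by rwa [← hQ']) hL hp
    rw [← hQ'] at h
    refine h.trans ?_
    gcongr
  have hI : Integrable (fun ω => 216 * (N * K) + 162 * (N *
      ((((noiseMatrix Z ω).transpose * noiseMatrix Z ω) ^ p).trace / (a * N) ^ p)) +
      440 * (m * n * e ^ 2 / η ^ 2)) P :=
    ((integrable_const _).add (((hint.div_const _).const_mul _).const_mul _)).add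
      (integrable_const _)
  have hbound := integral_mono_of_nonneg (ae_of_all P fun ω => frobSq_nonneg
    (usvt η (Q + noiseMatrix Z ω) - Q)) hI (ae_of_all P hpt)
  have hadd : ∀ (c c' : ℝ) (g : Ω → ℝ), Integrable g P →
      ∫ ω, (c + g ω + c') ∂P = c + ∫ ω, g ω ∂P + c' := by
    intro c c' g hg
    rw [integral_add (f := fun ω => c + g ω) ((integrable_const c).add hg) (integrable_const c'),
      integral_add (integrable_const c) hg]
    simp
  rw [hadd _ _ _ (((hint.div_const _).const_mul _).const_mul _), integral_const_mul,
    integral_const_mul, integral_div] at hbound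
  -- The powers of `N` cancel exactly and leave `m * n` times `(4 / a) ^ p`, up to the correction of
  -- order `1 / N`.
  have hT : N * ((∫ ω, (((noiseMatrix Z ω).transpose * noiseMatrix Z ω) ^ p).trace ∂P) /
      (a * N) ^ p) ≤ m * n * ((4 / a) ^ p * (1 + (2 * p + 1 : ℝ) ^ (2 * p + 1) / n)) := by
    calc _ ≤ N * ((4 ^ p * (1 + (2 * p + 1 : ℝ) ^ (2 * p + 1) / N) *
          (m * n * N ^ (p - 1))) / (a * N) ^ p) := by gcongr
      _ = m * n * ((4 / a) ^ p * (1 + (2 * p + 1 : ℝ) ^ (2 * p + 1) / N)) := by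
          obtain ⟨q, rfl⟩ : ∃ q, p = q + 1 := ⟨p - 1, by omega⟩
          rw [Nat.add_sub_cancel, mul_pow, div_pow, pow_succ N]
          have : N ^ q ≠ 0 := by positivity
          field_simp
      _ ≤ _ := by gcongr
  have hK : N * K ≤ m * n * (K * (1 / m + 1 / n)) := by
    have : m * n * (K * (1 / m + 1 / n : ℝ)) = (m + n) * K := by field_simp; ring
    rw [this]
    gcongr
  rw [div_le_iff₀ (by positivity)]
  have h5 : m * n * e ^ 2 / η ^ 2 = m * n * (e ^ 2 / η ^ 2) := by ring
  rw [h5] at hbound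
  nlinarith [hbound, hT, hK]

end Consistency

/-! ### Consistency of USVT for entrywise continuous functions -/

section Consistency

/-- USVT is consistent for a matrix of bounded rank to which a continuous function is applied
entrywise. -/
theorem tendsto_integral_frobSq_usvt {m n : ℕ → ℕ} (hm : Tendsto m atTop atTop)
    (hn : Tendsto n atTop atTop) (hm0 : ∀ k, 0 < m k) (hn0 : ∀ k, 0 < n k)
    {M : ∀ k, Matrix (Fin (m k)) (Fin (n k)) ℝ} (hM : ∀ k i j, M k i j ∈ Icc (-1 : ℝ) 1)
    {r : ℕ} (hrank : ∀ k, (M k).rank ≤ r) {h : ℝ → ℝ} (hcont : ContinuousOn h (Icc (-1) 1))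
    (hmaps : MapsTo h (Icc (-1) 1) (Icc (-1) 1)) {Ω : ℕ → Type*} [∀ k, MeasurableSpace (Ω k)]
    {P : ∀ k, Measure (Ω k)} [∀ k, IsProbabilityMeasure (P k)]
    {Z : ∀ k, Fin (m k) × Fin (n k) → Ω k → ℝ} (hZ : ∀ k, IsCentredNoise (P k) (Z k))
    {η : ℝ} (hη : η ∈ Ioo (0 : ℝ) 1) :
    Tendsto (fun k => (∫ ω, frobSq (usvt η ((M k).map h + noiseMatrix (Z k) ω) - (M k).map h)
      ∂(P k)) / (m k * n k)) atTop (𝓝 0) := by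
  have hη0 := hη.1
  have hupper : ∀ ε > 0, ∀ᶠ k in atTop, (∫ ω, frobSq (usvt η ((M k).map h +
      noiseMatrix (Z k) ω) - (M k).map h) ∂(P k)) / (m k * n k) < ε := by
    intro ε hε
    -- The order of choices matters: the accuracy `e` fixes the polynomial and hence the rank bound
    -- `K`, then `p` makes the noise term small, and only then does `k` grow.
    obtain ⟨e, he, he'⟩ : ∃ e > 0, 440 * (e ^ 2 / η ^ 2) < ε / 3 := by
      have : Tendsto (fun e : ℝ => 440 * (e ^ 2 / η ^ 2)) (𝓝[>] 0) (𝓝 0) := by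
        refine tendsto_nhdsWithin_of_tendsto_nhds ?_
        have : Continuous fun e : ℝ => 440 * (e ^ 2 / η ^ 2) := by fun_prop
        simpa using this.tendsto 0
      exact ((eventually_mem_nhdsWithin).and
        (this.eventually (gt_mem_nhds (by positivity)))).exists
    obtain ⟨q, hq⟩ := exists_polynomial_near_of_continuousOn (-1) 1 h hcont e he
    set ρ : ℝ := 4 / (2 + η / 2) ^ 2 with hρ
    have hρ0 : 0 ≤ ρ := by positivity
    have hρ1 : ρ < 1 := by
      rw [hρ, div_lt_one (by positivity)]
      nlinarith
    obtain ⟨p, hp, hp'⟩ : ∃ p, 0 < p ∧ 162 * ρ ^ p < ε / 3 := by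
      have : Tendsto (fun p : ℕ => 162 * ρ ^ p) atTop (𝓝 (162 * 0)) :=
        (tendsto_pow_atTop_nhds_zero_of_lt_one hρ0 hρ1).const_mul _
      rw [mul_zero] at this
      exact ((eventually_gt_atTop 0).and
        (this.eventually (gt_mem_nhds (by positivity)))).exists
    set K := ∑ d ∈ Finset.range (q.natDegree + 1), r ^ d with hK
    have hlim : Tendsto (fun k => 216 * (K : ℝ) * (1 / (m k : ℝ) + 1 / (n k : ℝ)) +
        162 * (ρ ^ p * (1 + (2 * p + 1 : ℝ) ^ (2 * p + 1) / (n k : ℝ))) +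
        440 * (e ^ 2 / η ^ 2)) atTop (𝓝 (216 * (K : ℝ) * (0 + 0) +
        162 * (ρ ^ p * (1 + 0)) + 440 * (e ^ 2 / η ^ 2))) := by
      have h1 := tendsto_natCast_atTop_atTop (R := ℝ) |>.comp hm
      have h2 := tendsto_natCast_atTop_atTop (R := ℝ) |>.comp hn
      exact (((h1.const_div_atTop _).add (h2.const_div_atTop _)).const_mul _).add
        ((((h2.const_div_atTop _).const_add _).const_mul _).const_mul _) |>.add_const _
    have hlt : 216 * (K : ℝ) * (0 + 0) + 162 * (ρ ^ p * (1 + 0)) + 440 * (e ^ 2 / η ^ 2) < ε := by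
      linarith
    filter_upwards [hlim.eventually (gt_mem_nhds hlt)] with k hk
    refine lt_of_le_of_lt ?_ hk
    refine (hZ k).integral_frobSq_usvt_le hη (hm0 k) (hn0 k) (L := (M k).map q.eval)
      (fun i j => hmaps (hM k i j)) (fun i j => ?_) ?_ hp
    · rw [abs_sub_comm]
      exact (hq _ (hM k i j)).le
    · refine ((M k).rank_map_polynomial_le q).trans ?_
      exact Finset.sum_le_sum fun d _ => Nat.pow_le_pow_left (hrank k) d
  rw [tendsto_order]
  refine ⟨fun a ha => Eventually.of_forall fun k => ha.trans_le ?_, hupper⟩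
  exact div_nonneg (integral_nonneg fun _ => frobSq_nonneg _) (by positivity)

end Consistency

/-! ### The noise of the observation model -/

section Noise

variable {Ω : Type*} [MeasurableSpace Ω] {P : Measure Ω} {E : Type*} [Fintype E]

/-- If the members of two families of random variables are jointly independent, then the pairs of
corresponding members are independent. -/
theorem ProbabilityTheory.iIndepFun.prodMk_of_sumElim {U V : E → Ω → ℝ}
    (hU : ∀ e, Measurable (U e)) (hV : ∀ e, Measurable (V e))
    (h : iIndepFun (Sum.elim U V) P) : iIndepFun (fun e ω => (U e ω, V e ω)) P := by
  have := h.isProbabilityMeasure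
  have hUV : ∀ i, Measurable (Sum.elim U V i) := Sum.rec hU hV
  have hpU : ∀ e, IsProbabilityMeasure (P.map (U e)) :=
    fun e => Measure.isProbabilityMeasure_map (hU e).aemeasurable
  have hpV : ∀ e, IsProbabilityMeasure (P.map (V e)) :=
    fun e => Measure.isProbabilityMeasure_map (hV e).aemeasurable
  have hpUV : ∀ i, IsProbabilityMeasure (P.map (Sum.elim U V i)) :=
    fun i => Measure.isProbabilityMeasure_map (hUV i).aemeasurable
  rw [iIndepFun_iff_map_fun_eq_pi_map
    (fun e => ((hU e).prodMk (hV e)).aemeasurable)]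
  have hpair : ∀ e, P.map (fun ω => (U e ω, V e ω)) = (P.map (U e)).prod (P.map (V e)) := by
    intro e
    have hind : IndepFun (U e) (V e) P :=
      h.indepFun (i := Sum.inl e) (j := Sum.inr e) Sum.inl_ne_inr
    exact (indepFun_iff_map_prod_eq_prod_map_map (hU e).aemeasurable (hV e).aemeasurable).1 hind
  simp_rw [hpair]
  -- The joint law is a product over the sum of two copies of `E`; regrouping the coordinates into
  -- pairs gives the product of the pair laws.
  have hlaw := h.map_fun_eq_pi_map (fun i => (hUV i).aemeasurable)
  have h1 := (measurePreserving_sumPiEquivProdPi (fun i => P.map (Sum.elim U V i))).map_eq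
  have h2 := ((measurePreserving_arrowProdEquivProdArrow ℝ ℝ E (fun e => P.map (U e))
    (fun e => P.map (V e))).symm _).map_eq
  rw [← h2]
  have h3 : (Measure.pi fun i => P.map (U i)).prod (Measure.pi fun i => P.map (V i)) =
      P.map (fun ω => (fun e => U e ω, fun e => V e ω)) := by
    refine h1.symm.trans ?_
    rw [← hlaw, Measure.map_map (MeasurableEquiv.measurable _)
      (measurable_pi_iff.2 fun i => hUV i)]
    rfl
  rw [h3, Measure.map_map (MeasurableEquiv.measurable _)
    ((measurable_pi_iff.2 hU).prodMk (measurable_pi_iff.2 hV))]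
  rfl

-- Centring a variable bounded by 1 subtracts a mean bounded by 1, whence the bound 2, and the
-- variance is at most the second moment, whence the bound 1.
omit [Fintype E] in
theorem isCentredNoise_sub {V : E → Ω → ℝ} (hind : iIndepFun V P) (hV : ∀ e, Measurable (V e))
    (habs : ∀ e, ∀ᵐ ω ∂P, |V e ω| ≤ 1) {c : E → ℝ} (hc : ∀ e, ∫ ω, V e ω ∂P = c e) :
    IsCentredNoise P (fun e ω => V e ω - c e) := by
  have := hind.isProbabilityMeasure
  have hint : ∀ e, Integrable (V e) P := fun e =>
    Integrable.of_bound (hV e).aestronglyMeasurable 1 (habs e)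
  have hint2 : ∀ e, Integrable (fun ω => V e ω ^ 2) P := fun e => by
    refine Integrable.of_bound ((hV e).pow_const 2).aestronglyMeasurable 1 ?_
    filter_upwards [habs e] with ω hω
    rw [Real.norm_of_nonneg (sq_nonneg _)]
    exact (sq_le_one_iff_abs_le_one _).2 hω
  have hc1 : ∀ e, |c e| ≤ 1 := fun e => by
    have h := norm_integral_le_of_norm_le_const (f := V e) (habs e)
    rw [hc] at h
    simpa using h
  refine ⟨?_, fun e => (hV e).sub_const _, fun e => ?_, fun e => ?_, fun e => ?_⟩
  · exact hind.comp (fun e x => x - c e) (fun e => measurable_id.sub_const _)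
  · filter_upwards [habs e] with ω hω
    have := abs_sub (V e ω) (c e)
    linarith [hc1 e]
  · rw [integral_sub (hint e) (integrable_const _), hc]
    simp
  · have h1 : ∀ ω, (V e ω - c e) ^ 2 = V e ω ^ 2 - 2 * c e * V e ω + c e ^ 2 := fun ω => by ring
    simp_rw [h1]
    rw [integral_add (f := fun ω => V e ω ^ 2 - 2 * c e * V e ω)
      ((hint2 e).sub ((hint e).const_mul _)) (integrable_const _),
      integral_sub (hint2 e) ((hint e).const_mul _), integral_const_mul, hc]
    have h2 : ∫ ω, V e ω ^ 2 ∂P ≤ ∫ _ω, (1 : ℝ) ∂P := by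
      refine integral_mono_ae (hint2 e) (integrable_const _) ?_
      filter_upwards [habs e] with ω hω
      exact (sq_le_one_iff_abs_le_one _).2 hω
    simp only [integral_const, probReal_univ, one_smul] at h2 ⊢
    nlinarith [sq_nonneg (c e)]

variable {m n : ℕ} {M p : Matrix (Fin m) (Fin n) ℝ} {X : Fin m → Fin n → Ω → ℝ}
  {S : Fin m → Fin n → Set Ω}

namespace IsNoisyObservation

variable (h : IsNoisyObservation P M p X S)
include h

theorem measurable_revealMatrix (i : Fin m) (j : Fin n) :
    Measurable fun ω => revealMatrix S ω i j :=
  measurable_one.indicator (h.measurableSet_reveal i j)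

theorem measurable_zeroFilled (i : Fin m) (j : Fin n) :
    Measurable fun ω => zeroFilled X S ω i j :=
  (h.measurable_entry i j).indicator (h.measurableSet_reveal i j)

omit [MeasurableSpace Ω] h in
theorem zeroFilled_eq_mul (X : Fin m → Fin n → Ω → ℝ) (S : Fin m → Fin n → Set Ω) (i : Fin m)
    (j : Fin n) (ω : Ω) :
    zeroFilled X S ω i j = X i j ω * (S i j).indicator (1 : Ω → ℝ) ω := by
  by_cases hω : ω ∈ S i j <;> simp [zeroFilled, hω]

theorem isCentredNoise_reveal :
    IsCentredNoise P (fun (e : Fin m × Fin n) ω => revealMatrix S ω e.1 e.2 - p e.1 e.2) := by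
  refine isCentredNoise_sub (V := fun (e : Fin m × Fin n) ω => revealMatrix S ω e.1 e.2)
    (h.indep.precomp Sum.inr_injective) (fun e => h.measurable_revealMatrix e.1 e.2)
    (fun e => ae_of_all _ fun ω => ?_) (fun e => ?_)
  · by_cases hω : ω ∈ S e.1 e.2 <;> simp [revealMatrix, hω]
  · rw [← h.prob_reveal]
    exact integral_indicator_one (h.measurableSet_reveal e.1 e.2)

/-- Each entry is the product of a value and its independent indicator, so the means multiply.
Across entries the value-indicator pairs are independent. -/
theorem isCentredNoise_zeroFilled :
    IsCentredNoise P (fun (e : Fin m × Fin n) ω =>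
      zeroFilled X S ω e.1 e.2 - M e.1 e.2 * p e.1 e.2) := by
  have hmI : ∀ e : Fin m × Fin n, Measurable ((S e.1 e.2).indicator (1 : Ω → ℝ)) :=
    fun e => measurable_one.indicator (h.measurableSet_reveal e.1 e.2)
  refine isCentredNoise_sub
    (V := fun (e : Fin m × Fin n) ω => zeroFilled X S ω e.1 e.2) ?_
    (fun e => h.measurable_zeroFilled e.1 e.2) (fun e => ?_) (fun e => ?_)
  · have h1 := iIndepFun.prodMk_of_sumElim (fun e : Fin m × Fin n => h.measurable_entry e.1 e.2) hmI h.indep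
    have h2 := h1.comp (fun _ x => x.1 * x.2) (fun _ => measurable_fst.mul measurable_snd)
    convert h2 using 2 with e
    funext ω
    exact zeroFilled_eq_mul X S e.1 e.2 ω
  · filter_upwards [h.entry_mem e.1 e.2] with ω hω
    by_cases hS : ω ∈ S e.1 e.2
    · simpa [zeroFilled, hS] using abs_le.2 hω
    · simp [zeroFilled, hS]
  · have hind : IndepFun (X e.1 e.2) ((S e.1 e.2).indicator (1 : Ω → ℝ)) P :=
      h.indep.indepFun (i := Sum.inl e) (j := Sum.inr e) Sum.inl_ne_inr
    simp_rw [zeroFilled_eq_mul]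
    rw [hind.integral_fun_mul_eq_mul_integral
      (h.measurable_entry e.1 e.2).aestronglyMeasurable (hmI e).aestronglyMeasurable,
      h.integral_entry, integral_indicator_one (h.measurableSet_reveal e.1 e.2), h.prob_reveal]

end IsNoisyObservation

end Noise

/-! ### The ratio of the two estimates -/

section Ratio

/-- If `b ≥ δ / 2` the division is stable. Otherwise, including `b = 0`, the denominator is already
wrong by at least `δ / 2`, while truncation keeps the error below 2. -/
theorem trunc_div_sub_sq_le {x r a b δ : ℝ} (hx : x ∈ Icc (-1 : ℝ) 1) (hr : r ∈ Icc (0 : ℝ) 1)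
    (hδ : 0 < δ) (hrδ : δ < r) :
    (trunc (a / b) - x) ^ 2 ≤ 32 / δ ^ 2 * ((a - x * r) ^ 2 + (b - r) ^ 2) := by
  have hδ1 : δ ≤ 1 := hrδ.le.trans hr.2
  have key : |trunc (a / b) - x| ≤ 4 / δ * (|a - x * r| + |b - r|) := by
    have hxabs := abs_le.2 hx
    by_cases hb : δ / 2 ≤ b
    · have hb0 : 0 < b := by linarith
      have h1 : |trunc (a / b) - x| ≤ |a / b - x| := sq_le_sq.1 (trunc_sub_sq_le _ hx)
      have h2 : a / b - x = ((a - x * r) + x * (r - b)) / b := by field_simp; ring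
      have h3 : |(a - x * r) + x * (r - b)| ≤ |a - x * r| + |b - r| := by
        refine (abs_add_le _ _).trans ?_
        rw [abs_mul, abs_sub_comm r b]
        gcongr
        exact mul_le_of_le_one_left (abs_nonneg _) hxabs
      calc |trunc (a / b) - x| ≤ |a / b - x| := h1
        _ = |(a - x * r) + x * (r - b)| / b := by rw [h2, abs_div, abs_of_pos hb0]
        _ ≤ (|a - x * r| + |b - r|) / (δ / 4) := by gcongr; linarith
        _ = _ := by field_simp
    · have h1 : |trunc (a / b) - x| ≤ 2 := by
        have := trunc_mem_Icc (a / b)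
        rw [abs_le]
        exact ⟨by linarith [this.1, hx.2], by linarith [this.2, hx.1]⟩
      have h2 : δ / 2 ≤ |b - r| := by
        rw [abs_sub_comm]
        exact le_trans (by linarith) (le_abs_self _)
      have h3 : 0 ≤ |a - x * r| := abs_nonneg _
      calc |trunc (a / b) - x| ≤ 2 := h1
        _ = 4 / δ * (δ / 2) := by field_simp; norm_num
        _ ≤ _ := by gcongr; linarith
  rw [← sq_abs]
  calc |trunc (a / b) - x| ^ 2 ≤ (4 / δ * (|a - x * r| + |b - r|)) ^ 2 := by gcongr
    _ = 16 / δ ^ 2 * (|a - x * r| + |b - r|) ^ 2 := by ring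
    _ ≤ 16 / δ ^ 2 * (2 * (|a - x * r| ^ 2 + |b - r| ^ 2)) := by
        gcongr
        exact add_sq_le
    _ = _ := by rw [sq_abs, sq_abs]; ring

theorem trunc_sub_sq_le_four (a : ℝ) {x : ℝ} (hx : x ∈ Icc (-1 : ℝ) 1) :
    (trunc a - x) ^ 2 ≤ 4 := by
  obtain ⟨h1, h2⟩ := trunc_mem_Icc a
  obtain ⟨h3, h4⟩ := hx
  nlinarith

variable {m n : ℕ}

theorem real_empiricalDist [NeZero m] [NeZero n] (M : Matrix (Fin m) (Fin n) ℝ) {F : Set ℝ}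
    (hF : MeasurableSet F) : (empiricalDist M : Measure ℝ).real F =
      (∑ i, ∑ j, F.indicator (1 : ℝ → ℝ) (M i j)) / (m * n) := by
  have h1 : (empiricalDist M : Measure ℝ) =
      ((m : ℝ≥0∞) * n)⁻¹ • ∑ i, ∑ j, Measure.dirac (M i j) := rfl
  have h2 : ∀ x : ℝ, (Measure.dirac x).real F = F.indicator (1 : ℝ → ℝ) x := by
    intro x
    rw [Measure.real, Measure.dirac_apply' _ hF]
    by_cases hx : x ∈ F <;> simp [hx]
  rw [h1, measureReal_ennreal_smul_apply, div_eq_inv_mul]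
  congr 1
  · simp
  · rw [Measure.real, Measure.finsetSum_apply, ENNReal.toReal_sum (fun i _ => measure_ne_top _ _)]
    refine Finset.sum_congr rfl fun i _ => ?_
    rw [Measure.finsetSum_apply, ENNReal.toReal_sum (fun i _ => measure_ne_top _ _)]
    exact Finset.sum_congr rfl fun j _ => h2 _

theorem empiricalDist_compl_Icc [NeZero m] [NeZero n] {M : Matrix (Fin m) (Fin n) ℝ}
    (hM : ∀ i j, M i j ∈ Icc (-1 : ℝ) 1) : empiricalDist M (Icc (-1) 1)ᶜ = 0 := by
  have h1 : (empiricalDist M : Measure ℝ).real (Icc (-1) 1)ᶜ = 0 := by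
    rw [real_empiricalDist M measurableSet_Icc.compl]
    simp [hM]
  exact NNReal.coe_eq_zero.1 h1

theorem avgSqError_nonneg (M A : Matrix (Fin m) (Fin n) ℝ) : 0 ≤ avgSqError M A :=
  mul_nonneg (by positivity) (Finset.sum_nonneg fun _ _ => Finset.sum_nonneg fun _ _ => sq_nonneg _)

/-- Where `g > δ` the ratio estimate applies; elsewhere the squared error is at most 4 and such
entries are counted by the empirical distribution. -/
theorem avgSqError_modifiedUSVT_le [NeZero m] [NeZero n] {M : Matrix (Fin m) (Fin n) ℝ}
    (hM : ∀ i j, M i j ∈ Icc (-1 : ℝ) 1) {g : ℝ → ℝ} (hg : MapsTo g (Icc (-1) 1) (Icc 0 1))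
    {δ : ℝ} (hδ : 0 < δ) (hF : MeasurableSet (Icc (-1) 1 ∩ g ⁻¹' Iic δ))
    (η : ℝ) (Y Q : Matrix (Fin m) (Fin n) ℝ) :
    avgSqError M (modifiedUSVT η Y Q) ≤
      32 / δ ^ 2 * (frobSq (usvt η Y - M.map fun x => x * g x) / (m * n) +
        frobSq (usvt η Q - M.map g) / (m * n)) +
      4 * (empiricalDist M : Measure ℝ).real (Icc (-1) 1 ∩ g ⁻¹' Iic δ) := by
  have hm : (0 : ℝ) < m := by exact_mod_cast NeZero.pos m
  have hn : (0 : ℝ) < n := by exact_mod_cast NeZero.pos n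
  rw [real_empiricalDist M hF]
  have key : ∑ i, ∑ j, (modifiedUSVT η Y Q i j - M i j) ^ 2 ≤
      32 / δ ^ 2 * (frobSq (usvt η Y - M.map fun x => x * g x) + frobSq (usvt η Q - M.map g)) +
      4 * ∑ i, ∑ j, (Icc (-1) 1 ∩ g ⁻¹' Iic δ).indicator (1 : ℝ → ℝ) (M i j) := by
    simp only [frobSq, ← Finset.sum_add_distrib, Finset.mul_sum]
    refine Finset.sum_le_sum fun i _ => Finset.sum_le_sum fun j _ => ?_
    by_cases hmem : M i j ∈ Icc (-1) 1 ∩ g ⁻¹' Iic δ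
    · rw [indicator_of_mem hmem]
      have h1 := trunc_sub_sq_le_four (usvt η Y i j / usvt η Q i j) (hM i j)
      have h2 : 0 ≤ 32 / δ ^ 2 * ((usvt η Y - M.map fun x => x * g x) i j ^ 2 +
        (usvt η Q - M.map g) i j ^ 2) := by positivity
      have h3 : modifiedUSVT η Y Q i j = trunc (usvt η Y i j / usvt η Q i j) := rfl
      rw [h3, Pi.one_apply]
      linarith
    · rw [indicator_of_notMem hmem, mul_zero, add_zero]
      refine trunc_div_sub_sq_le (hM i j) (hg (hM i j)) hδ ?_
      by_contra hcon
      exact hmem ⟨hM i j, not_lt.1 hcon⟩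
  rw [avgSqError, one_div, ← div_eq_inv_mul, div_le_iff₀ (by positivity)]
  refine key.trans_eq ?_
  field_simp

end Ratio

/-! ### Weak limits on a compact interval and sublevel sets -/

section WeakLimit

theorem exists_subseq_tendsto_of_compl_Icc_eq_zero {ν : ℕ → ProbabilityMeasure ℝ}
    (hν : ∀ k, ν k (Icc (-1) 1)ᶜ = 0) :
    ∃ (μ : ProbabilityMeasure ℝ) (φ : ℕ → ℕ), StrictMono φ ∧ Tendsto (ν ∘ φ) atTop (𝓝 μ) ∧
      μ (Icc (-1) 1)ᶜ = 0 := by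
  have hc := isCompact_setOfPred_probabilityMeasure_mass_eq_compl_isCompact_le
    (u := fun _ => 0) (K := fun _ => Icc (-1 : ℝ) 1) tendsto_const_nhds
    (fun _ => isCompact_Icc) (Or.inr monotone_const)
  obtain ⟨μ, hμ, φ, hφ, hlim⟩ := hc.isSeqCompact (x := ν) fun k _ => (hν k).le
  exact ⟨μ, φ, hφ, hlim, le_antisymm (hμ 0) zero_le⟩

/-- The sublevel sets decrease to the zero set of `g`, which misses the support and is therefore
null; continuity from above does the rest. -/
theorem exists_pos_measure_sublevel_lt {μ : Measure ℝ} [IsFiniteMeasure μ] {g : ℝ → ℝ}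
    (hg : MapsTo g (Icc (-1) 1) (Icc 0 1)) (hcont : ContinuousOn g (Icc (-1) 1))
    (hsupp : ∀ x ∈ μ.support, g x ≠ 0) {ε : ℝ≥0∞} (hε : 0 < ε) :
    ∃ δ > 0, μ (Icc (-1) 1 ∩ g ⁻¹' Iic δ) < ε := by
  have hclosed : ∀ δ, IsClosed (Icc (-1) 1 ∩ g ⁻¹' Iic δ) := fun δ =>
    hcont.preimage_isClosed_of_isClosed isClosed_Icc isClosed_Iic
  have hzero : μ (⋂ l : ℕ, Icc (-1) 1 ∩ g ⁻¹' Iic (1 / ((l : ℝ) + 1))) = 0 := by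
    refine measure_mono_null ?_ (Measure.measure_compl_support (μ := μ))
    intro x hx hxs
    rw [mem_iInter] at hx
    refine hsupp x hxs (le_antisymm ?_ (hg (hx 0).1).1)
    exact ge_of_tendsto' (tendsto_one_div_add_atTop_nhds_zero_nat (𝕜 := ℝ)) fun l => (hx l).2
  have hlim := tendsto_measure_iInter_atTop (μ := μ)
    (s := fun l : ℕ => Icc (-1) 1 ∩ g ⁻¹' Iic (1 / ((l : ℝ) + 1)))
    (fun l => (hclosed _).measurableSet.nullMeasurableSet)
    (fun a b hab x hx => ⟨hx.1, show g x ≤ _ from le_trans hx.2 (Nat.one_div_le_one_div hab)⟩)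
    ⟨0, measure_ne_top _ _⟩
  rw [hzero] at hlim
  obtain ⟨l, hl⟩ := (hlim.eventually (gt_mem_nhds hε)).exists
  exact ⟨_, Nat.one_div_pos_of_nat, hl⟩

end WeakLimit

/-! ### Consistency of the modified estimator -/

theorem integrable_avgSqError_modifiedUSVT {m n : ℕ} {Ω : Type*} [MeasurableSpace Ω]
    {P : Measure Ω} [IsProbabilityMeasure P] {M : Matrix (Fin m) (Fin n) ℝ}
    (hM : ∀ i j, M i j ∈ Icc (-1 : ℝ) 1) {η : ℝ} (hη : 0 < η) (hm : 0 < m)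
    {Y Q : Ω → Matrix (Fin m) (Fin n) ℝ} (hY : ∀ i j, Measurable fun ω => Y ω i j)
    (hQ : ∀ i j, Measurable fun ω => Q ω i j) :
    Integrable (fun ω => avgSqError M (modifiedUSVT η (Y ω) (Q ω))) P := by
  have hmeas : Measurable fun ω => avgSqError M (modifiedUSVT η (Y ω) (Q ω)) := by
    refine Measurable.const_mul (Finset.measurable_fun_sum _ fun i _ =>
      Finset.measurable_fun_sum _ fun j _ => ?_) _
    exact ((measurable_modifiedUSVT hη hm hY hQ i j).sub_const _).pow_const 2
  refine Integrable.of_bound hmeas.aestronglyMeasurable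
    (1 / ((m : ℝ) * n) * ∑ _i : Fin m, ∑ _j : Fin n, 4) (ae_of_all _ fun ω => ?_)
  rw [Real.norm_of_nonneg (avgSqError_nonneg _ _), avgSqError]
  gcongr with i _ j _
  exact trunc_sub_sq_le_four _ (hM i j)

theorem theorem2p1
    (m n : ℕ → ℕ) [∀ k, NeZero (m k)] [∀ k, NeZero (n k)]
    (hm : Tendsto m atTop atTop) (hn : Tendsto n atTop atTop)
    (M : ∀ k, Matrix (Fin (m k)) (Fin (n k)) ℝ)
    (hM : ∀ k i j, M k i j ∈ Icc (-1 : ℝ) 1)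
    (f : entrySet M → Icc (0 : ℝ) 1)
    {Ω : ℕ → Type*} [∀ k, MeasurableSpace (Ω k)]
    (P : ∀ k, Measure (Ω k)) [∀ k, IsProbabilityMeasure (P k)]
    (X : ∀ k, Fin (m k) → Fin (n k) → Ω k → ℝ)
    (S : ∀ k, Fin (m k) → Fin (n k) → Set (Ω k))
    (hobs : ∀ k, IsNoisyObservation (P k) (M k)
      (Matrix.of fun i j => (f ⟨M k i j, k, i, j, rfl⟩ : ℝ)) (X k) (S k))
    (hrank : ∃ r : ℕ, ∀ k, (M k).rank ≤ r)
    (hf : ∀ μ : ProbabilityMeasure ℝ, IsSubseqWeakLimit (fun k => empiricalDist (M k)) μ →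
      ∃ g : ℝ → ℝ, MapsTo g (Icc (-1) 1) (Icc 0 1) ∧
        (∃ L, LipschitzOnWith L g (Icc (-1) 1)) ∧
        (∀ x : entrySet M, g x = f x) ∧
        ∀ x ∈ (μ : Measure ℝ).support, g x ≠ 0)
    (η : ℝ) (hη : η ∈ Ioo (0 : ℝ) 1) :
    (∀ k, Integrable (fun ω => avgSqError (M k)
      (modifiedUSVT η (zeroFilled (X k) (S k) ω) (revealMatrix (S k) ω))) (P k)) ∧
    Tendsto (fun k => mse (P k) (M k)
      (fun ω => modifiedUSVT η (zeroFilled (X k) (S k) ω) (revealMatrix (S k) ω)))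
      atTop (𝓝 0) := by
  have hη0 := hη.1
  -- This ensures that the Bochner integral in `mse` is the true expectation and not its default
  -- value 0.
  have hint : ∀ k, Integrable (fun ω => avgSqError (M k)
      (modifiedUSVT η (zeroFilled (X k) (S k) ω) (revealMatrix (S k) ω))) (P k) := fun k =>
    integrable_avgSqError_modifiedUSVT (hM k) hη0 (NeZero.pos _) (hobs k).measurable_zeroFilled
      (hobs k).measurable_revealMatrix
  refine ⟨hint, ?_⟩
  obtain ⟨r, hr⟩ := hrank
  -- Every subsequence needs a further one along which the error vanishes. `g` depends on the weak
  -- limit and so can be chosen only after passing to it; `ψ` makes the indices strictly increasing.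
  refine tendsto_of_subseq_tendsto fun ns hns => ?_
  obtain ⟨ψ, -, hψ⟩ := strictMono_subseq_of_tendsto_atTop hns
  obtain ⟨μ, φ, hφ, hlim, -⟩ := exists_subseq_tendsto_of_compl_Icc_eq_zero
    (ν := fun l => empiricalDist (M (ns (ψ l)))) fun l => empiricalDist_compl_Icc (hM _)
  obtain ⟨g, hg, ⟨c, hLip⟩, hgf, hsupp⟩ := hf μ ⟨fun l => ns (ψ (φ l)), hψ.comp hφ, hlim⟩
  have hcont : ContinuousOn g (Icc (-1) 1) := hLip.continuousOn
  refine ⟨fun l => ψ (φ l), ?_⟩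
  have hfg : ∀ k i j, (f ⟨M k i j, k, i, j, rfl⟩ : ℝ) = g (M k i j) := fun k i j =>
    (hgf ⟨M k i j, k, i, j, rfl⟩).symm
  have hmapsR : MapsTo g (Icc (-1) 1) (Icc (-1) 1) := fun x hx =>
    ⟨by linarith [(hg hx).1], (hg hx).2⟩
  have hmapsQ : MapsTo (fun x => x * g x) (Icc (-1) 1) (Icc (-1) 1) := fun x hx => by
    rw [mem_Icc, ← abs_le, abs_mul]
    exact mul_le_one₀ (abs_le.2 hx) (abs_nonneg _) (abs_le.2 (hmapsR hx))
  -- Since `g` agrees with `f` on the entries of all the matrices, both recovery statements hold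
  -- along the full sequence; only the mass of the sublevel set needs the subsequence.
  have hQ := tendsto_integral_frobSq_usvt hm hn (fun k => NeZero.pos _) (fun k => NeZero.pos _)
    hM hr (h := fun x => x * g x) (continuousOn_id.mul hcont) hmapsQ (fun k => (hobs k).isCentredNoise_zeroFilled) hη
  have hR := tendsto_integral_frobSq_usvt hm hn (fun k => NeZero.pos _) (fun k => NeZero.pos _)
    hM hr hcont hmapsR (fun k => (hobs k).isCentredNoise_reveal) hη
  have hYeq : ∀ k ω, (M k).map (fun x => x * g x) + noiseMatrix (fun e ω =>
      zeroFilled (X k) (S k) ω e.1 e.2 - M k e.1 e.2 * (Matrix.of fun i j =>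
        (f ⟨M k i j, k, i, j, rfl⟩ : ℝ)) e.1 e.2) ω = zeroFilled (X k) (S k) ω := by
    intro k ω
    ext i j
    simp [noiseMatrix, hfg]
  have hPeq : ∀ k ω, (M k).map g + noiseMatrix (fun e ω =>
      revealMatrix (S k) ω e.1 e.2 - (Matrix.of fun i j =>
        (f ⟨M k i j, k, i, j, rfl⟩ : ℝ)) e.1 e.2) ω = revealMatrix (S k) ω := by
    intro k ω
    ext i j
    simp [noiseMatrix, hfg]
  replace hQ := hQ.congr fun k => congrArg (· / ((m k : ℝ) * n k)) <| integral_congr_ae <|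
    ae_of_all _ fun ω => congrArg (fun B => frobSq (usvt η B - (M k).map fun x => x * g x))
      (hYeq k ω)
  replace hR := hR.congr fun k => congrArg (· / ((m k : ℝ) * n k)) <| integral_congr_ae <|
    ae_of_all _ fun ω => congrArg (fun B => frobSq (usvt η B - (M k).map g)) (hPeq k ω)
  have hbound : ∀ δ > 0, ∀ k, mse (P k) (M k)
      (fun ω => modifiedUSVT η (zeroFilled (X k) (S k) ω) (revealMatrix (S k) ω)) ≤
      32 / δ ^ 2 * ((∫ ω, frobSq (usvt η (zeroFilled (X k) (S k) ω) -
          (M k).map fun x => x * g x) ∂(P k)) / (m k * n k) +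
        (∫ ω, frobSq (usvt η (revealMatrix (S k) ω) - (M k).map g) ∂(P k)) / (m k * n k)) +
      4 * (empiricalDist (M k) : Measure ℝ).real (Icc (-1) 1 ∩ g ⁻¹' Iic δ) := by
    intro δ hδ k
    have hF : MeasurableSet (Icc (-1) 1 ∩ g ⁻¹' Iic δ) :=
      (hcont.preimage_isClosed_of_isClosed isClosed_Icc isClosed_Iic).measurableSet
    have hiQ := integrable_frobSq_usvt_sub (P := P k) hη0 (NeZero.pos _)
      (hobs k).measurable_zeroFilled (Q := (M k).map fun x => x * g x)
      (fun i j => hmapsQ (hM k i j))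
    have hiR := integrable_frobSq_usvt_sub (P := P k) hη0 (NeZero.pos _)
      (hobs k).measurable_revealMatrix (Q := (M k).map g) (fun i j => hmapsR (hM k i j))
    have hmono := integral_mono (hint k)
      ((((hiQ.div_const _).add (hiR.div_const _)).const_mul (32 / δ ^ 2)).add (integrable_const _))
      (fun ω => avgSqError_modifiedUSVT_le (hM k) hg hδ hF η _ _)
    refine hmono.trans_eq ?_
    rw [integral_add' (((hiQ.div_const _).add (hiR.div_const _)).const_mul (32 / δ ^ 2))
      (integrable_const _), integral_const_mul, integral_add' (hiQ.div_const _) (hiR.div_const _),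
      integral_div, integral_div]
    simp
  have hsub : Tendsto (fun l => ns (ψ (φ l))) atTop atTop := (hψ.comp hφ).tendsto_atTop
  rw [tendsto_order]
  refine ⟨fun a ha => Eventually.of_forall fun l => ha.trans_le
    (integral_nonneg fun ω => avgSqError_nonneg _ _), fun ε hε => ?_⟩
  -- The factor 4 in the error bound turns `ε / 8` into `ε / 2`; the two recovery errors get the
  -- other half.
  obtain ⟨δ, hδ, hμδ⟩ := exists_pos_measure_sublevel_lt hg hcont hsupp
    (ε := ENNReal.ofReal (ε / 8)) (ENNReal.ofReal_pos.2 (by positivity))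
  have hclosed : IsClosed (Icc (-1) 1 ∩ g ⁻¹' Iic δ) :=
    hcont.preimage_isClosed_of_isClosed isClosed_Icc isClosed_Iic
  -- Portmanteau for closed sets transfers the smallness from `μ` to the empirical distributions.
  have hev := eventually_lt_of_limsup_lt
    ((ProbabilityMeasure.limsup_measure_closed_le_of_tendsto hlim hclosed).trans_lt hμδ)
  have herr := (((hQ.add hR).const_mul (32 / δ ^ 2)).comp hsub)
  rw [add_zero, mul_zero] at herr
  filter_upwards [hev, herr.eventually (gt_mem_nhds (show 0 < ε / 2 by positivity))] with l h1 h2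
  have h3 := hbound δ hδ (ns (ψ (φ l)))
  have h4 : (empiricalDist (M (ns (ψ (φ l)))) : Measure ℝ).real (Icc (-1) 1 ∩ g ⁻¹' Iic δ) <
      ε / 8 := (ENNReal.lt_ofReal_iff_toReal_lt (measure_ne_top _ _)).1 h1
  simp only [Function.comp_apply] at h2
  linarith
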